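/- Let $\Omega\subseteq\mathbb C^{n+m}$ be an $n$-star-shaped Hartogs domain in the first $n$ variables, i.e. a nonempty connected open set such that $(z_1,\dots,z_n,z')\in\Omega$ implies $(\lambda_1z_1,\dots,\lambda_nz_n,z')\in\Omega$ for all $\lambda\in\mathbb C^n$ with $|\lambda_j|\le 1$ for all $j$. Let $\gamma_1,\dots,\gamma_n>0$ and put $$V^\gamma=\{(z,z',w)\in\mathbb C^{n}\times\mathbb C^m\times\mathbb C:\ ((e^{\gamma_j|w|^2/2}z_j)_{j=1}^n,z')\in\Omega\},\qquad V^\gamma_\eta=\{(z,z')\in\mathbb C^{n+m}:(z,z',\eta)\in V^\gamma\}.$$ For an open set $G\subseteq\mathbb C^N$, let $A^2(G)$ be the Hilbert space of holomorphic functions on $G$ that are square integrable with respect to Lebesgue measure $dV$, and let $K_G$ be its Bergman kernel: for $p\in G$, $q\mapsto\overline{K_G(p;\bar q)}$ is the element of $A^2(G)$ with $f(p)=\int_G K_G(p;\bar q)f(q)\,dV(q)$ for all $f\in A^2(G)$. For $z\in\mathbb C^n$ and $w,\eta\in\mathbb C$, let $$l(z,w,\eta)=\bigl(z_je^{\gamma_j(w\bar\eta-|\eta|^2)}\bigr)_{j=1}^n,\qquad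 D_{V^\gamma}=\frac{e^{(\gamma_1+\dots+\gamma_n)(w\bar\eta-|\eta|^2)}}{\pi}\sum_{j=1}^n\gamma_j\Bigl(I+z_j\frac{\partial}{\partial z_j}\Bigr),$$ where $I$ is the identity operator. Then for all $(z,z',w),(\zeta,\zeta',\eta)\in V^\gamma$ the point $(l(z,w,\eta),z')$ lies in $V^\gamma_\eta$, the function $u\mapsto K_{V^\gamma_\eta}(l(u,w,\eta),z';\bar\zeta,\bar\zeta')$ is complex differentiable at $u=z$, and $$K_{V^\gamma}(z,z',w;\bar\zeta,\bar\zeta',\bar\eta)=D_{V^\gamma}\,K_{V^\gamma_\eta}\bigl(l(z,w,\eta),z';\bar\zeta,\bar\zeta'\bigr),$$ where $D_{V^\gamma}$ acts in the variable $z$ on the function $z\mapsto K_{V^\gamma_\eta}(l(z,w,\eta),z';\bar\zeta,\bar\zeta')$. -/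

import Mathlib

open MeasureTheory ComplexConjugate

noncomputable section

namespace BergmanTarget

section Kernel

variable {E : Type*} [NormedAddCommGroup E] [NormedSpace ℂ E] [MeasureSpace E]

/-- The Bergman space: functions that are holomorphic on `Ω` and square integrable on `Ω`
(two functions that agree on `Ω` represent the same element). -/
def bergmanSpace (Ω : Set E) : Set (E → ℂ) :=
  {f | DifferentiableOn ℂ f Ω ∧ MemLp f 2 (volume.restrict Ω)}

/-- `k` is the Riesz representer, in the Bergman space of `Ω`, of evaluation at `z`. -/
def IsRepresenter (Ω : Set E) (z : E) (k : E → ℂ) : Prop :=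
  k ∈ bergmanSpace Ω ∧ ∀ f ∈ bergmanSpace Ω, f z = ∫ ζ in Ω, conj (k ζ) * f ζ

open Classical in
/-- The Bergman kernel function `K_Ω(z; ζ̄)`, so that `f z = ∫ K_Ω(z; ζ̄) f ζ` for `f` in the
Bergman space. For an open set `Ω` of a complex coordinate space and `z, ζ ∈ Ω`, the representer
exists by the Riesz theorem, and its value at `ζ` does not depend on the choice;
the value `0` is never used there. -/
def bergmanKernel (Ω : Set E) (z ζ : E) : ℂ :=
  if h : ∃ k, IsRepresenter Ω z k then conj (h.choose ζ) else 0

end Kernel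

/-- `Ω ⊆ ℂⁿ × ℂᵐ` is a domain that is `n`-star-shaped Hartogs in the first `n` variables. -/
structure IsStarShapedHartogs {n m : ℕ} (Ω : Set ((Fin n → ℂ) × (Fin m → ℂ))) : Prop where
  isOpen : IsOpen Ω
  isConnected : IsConnected Ω
  smul_mem : ∀ z z', (z, z') ∈ Ω → ∀ c : Fin n → ℂ, (∀ j, ‖c j‖ ≤ 1) →
    ((fun j => c j * z j), z') ∈ Ω

/-- The map `g_γ(z, w) = (exp(γ_j |w|² / 2) z_j)_j`. -/
def gMap {n : ℕ} (γ : Fin n → ℝ) (z : Fin n → ℂ) (w : ℂ) : Fin n → ℂ :=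
  fun j => (Real.exp (γ j * ‖w‖ ^ 2 / 2) : ℂ) * z j

/-- The target domain `V^γ`; a point `(z, z', w)` is written `((z, z'), w)`. -/
def targetV {n m : ℕ} (γ : Fin n → ℝ) (Ω : Set ((Fin n → ℂ) × (Fin m → ℂ))) :
    Set (((Fin n → ℂ) × (Fin m → ℂ)) × ℂ) :=
  {p | (gMap γ p.1.1 p.2, p.1.2) ∈ Ω}

/-- The slice `V^γ_η` of `V^γ`. -/
def sliceV {n m : ℕ} (γ : Fin n → ℝ) (Ω : Set ((Fin n → ℂ) × (Fin m → ℂ))) (η : ℂ) :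
    Set ((Fin n → ℂ) × (Fin m → ℂ)) :=
  {q | (q, η) ∈ targetV γ Ω}

/-- The map `l(z, w, η) = (z_j exp(γ_j (w η̄ - |η|²)))_j`. -/
def lMap {n : ℕ} (γ : Fin n → ℝ) (z : Fin n → ℂ) (w η : ℂ) : Fin n → ℂ :=
  fun j => z j * Complex.exp ((γ j : ℂ) * (w * conj η - (‖η‖ : ℂ) ^ 2))

/-- The complex partial derivative `∂F/∂z_j` at `z`. -/
def partialDeriv {n : ℕ} (j : Fin n) (F : (Fin n → ℂ) → ℂ) (z : Fin n → ℂ) : ℂ :=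
  deriv (fun t : ℂ => F (Function.update z j t)) (z j)

/-- The operator
`D_{V^γ} = π⁻¹ exp((γ·1)(w η̄ - |η|²)) ∑_j γ_j (I + z_j ∂/∂z_j)`, for fixed `w, η`. -/
def operatorD {n : ℕ} (γ : Fin n → ℝ) (w η : ℂ) (F : (Fin n → ℂ) → ℂ) (z : Fin n → ℂ) : ℂ :=
  Complex.exp (((∑ j, γ j : ℝ) : ℂ) * (w * conj η - (‖η‖ : ℂ) ^ 2)) / (Real.pi : ℂ) *
    ∑ j, (γ j : ℂ) * (F z + z j * partialDeriv j F z)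

end BergmanTarget

end

/-!
The kernel identity is proved by checking that its right hand side reproduces; no expansion in
powers of `z` is used. Write `G` for the slice over `η`, `q = (ζ, ζ')`, `Γ = ∑ γ_j`, and
`σ_s(z, z') = ((e^{γ_j s} z_j)_j, z')` for the flow with complex time `s` (`scale`). The slice `G`
is stable under `σ_s` for `Re s ≤ 0`, the target domain is
`{(p, w) : σ_a p ∈ G}` with `a = (|w|² - |η|²) / 2` (`targetV_eq_fibredDomain`), and the right hand
side is `R(p, w) = π⁻¹ ∂_s (e^{Γ s} K_G(σ_s p; q̄))` at `s = w η̄ - |η|²`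
(`operatorD_eq_deriv_orbit`).

For imaginary `s` the flow acts unitarily on the Bergman space of `G`, so
`K_G(σ_s u; q̄)` is unchanged when `σ_s` is moved to `σ_{s̄}` on the other argument; the identity
principle extends this to `Re s ≤ 0` (`IsRepresenter.apply_scale`). Hence
`u ↦ ∂_s (e^{Γ s} K_G(σ_s u; q̄))` is the Riesz representer of the bounded functional
`φ ↦ ∂_τ (e^{Γ τ} φ(σ_τ q))` at `τ = s̄`, whose norm is `O(e^{Γ Re s})` by Cauchy's estimate
(`exists_riesz_deriv_orbit`). Transported to `G`, the fibre of `R` over `w` is such a representer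
with `Re s = -|w - η|² / 2`. This gives the Gaussian bound that puts `R` into `L²`
(`totalKernel_mem_bergmanSpace`), and it turns the inner integral of `f R̄` over the fibre into
`π⁻¹ ∂_τ F(τ, w)` at `τ = w̄ η - |w|²`, where `F(τ, w) = e^{Γ τ} f(σ_τ q, w)`
(`setIntegral_fibre_totalKernel`).

With `w = η + v` this is `∂_τ F(-|v|² - η̄ v, η + v)`. On the circle `|v|² = t` it agrees with the
restriction of a function holomorphic in `v`, so its mean is the value `∂_τ F(-t, η)` at the centre,
and the remaining radial integral telescopes to `F(0, η) = f(q, η)` because `F(-t, η)` tends to `0`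
when `Γ > 0` (`integral_deriv_orbit`). For `n = 0` the weight `Γ` vanishes; then the target domain is
`Ω × ℂ`, whose Bergman space is trivial.

The theory of Bergman spaces needed on the way is developed for open subsets of a finite-dimensional
complex space: Weierstrass' theorem, the sub-mean value inequality over balanced compact sets,
completeness, and the Riesz theorem `exists_riesz_bergmanSpace`.
-/

open MeasureTheory ComplexConjugate

namespace BergmanTarget

open Filter Topology Metric Set

/-! ### Holomorphic functions of several variables -/

section Holomorphic

variable {E : Type*} [NormedAddCommGroup E] [NormedSpace ℂ E]

/-- Weierstrass' theorem in any number of variables. The derivatives form a uniform Cauchy sequence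
on a smaller ball by the Cauchy estimate. -/
theorem differentiableAt_of_tendstoUniformlyOn {f : ℕ → E → ℂ} {g : E → ℂ} {x : E} {r : ℝ}
    (hr : 0 < r) (hf : ∀ k, DifferentiableOn ℂ (f k) (ball x r))
    (hfg : TendstoUniformlyOn f g atTop (ball x r)) : DifferentiableAt ℂ g x := by
  have hr2 : 0 < r / 2 := by positivity
  have hsub : ∀ y ∈ ball x (r / 2), ball y (r / 2) ⊆ ball x r := fun y hy =>
    ball_subset_ball' (by rw [mem_ball] at hy; linarith)
  have hsub' : ball x (r / 2) ⊆ ball x r := ball_subset_ball (by linarith)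
  have hdiff : ∀ k, ∀ y ∈ ball x r, DifferentiableAt ℂ (f k) y := fun k y hy =>
    (hf k).differentiableAt (isOpen_ball.mem_nhds hy)
  have hC : UniformCauchySeqOn (fun k => fderiv ℂ (f k)) atTop (ball x (r / 2)) := by
    rw [Metric.uniformCauchySeqOn_iff]
    intro ε hε
    obtain ⟨N, hN⟩ := Metric.uniformCauchySeqOn_iff.1 hfg.uniformCauchySeqOn (ε * (r / 8))
      (by positivity)
    refine ⟨N, fun k hk l hl y hy => ?_⟩
    have hmem : ∀ z ∈ ball y (r / 2), ‖f k z - f l z‖ < ε * (r / 8) := fun z hz => by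
      rw [← dist_eq_norm]; exact hN k hk l hl z (hsub y hy hz)
    have hb : ‖fderiv ℂ (fun z => f k z - f l z) y‖ ≤ (ε * (r / 4)) / (r / 2) := by
      refine Complex.norm_fderiv_le_div_of_mapsTo_ball
        (((hf k).mono (hsub y hy)).sub ((hf l).mono (hsub y hy))) ?_ hr2
      intro z hz
      rw [mem_closedBall, dist_eq_norm]
      have h1 := hmem z hz
      have h2 := hmem y (mem_ball_self hr2)
      have h3 := norm_sub_le (f k z - f l z) (f k y - f l y)
      linarith
    rw [fderiv_fun_sub (hdiff k y (hsub' hy)) (hdiff l y (hsub' hy))] at hb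
    rw [dist_eq_norm]
    refine hb.trans_lt ?_
    have : (ε * (r / 4)) / (r / 2) = ε / 2 := by field_simp; norm_num
    rw [this]; linarith
  have hlim : ∀ y ∈ ball x (r / 2), ∃ A, Tendsto (fun k => fderiv ℂ (f k) y) atTop (𝓝 A) :=
    fun y hy => cauchySeq_tendsto_of_complete (hC.cauchySeq hy)
  choose! A hA using hlim
  have hU : TendstoUniformlyOn (fun k => fderiv ℂ (f k)) A atTop (ball x (r / 2)) :=
    hC.tendstoUniformlyOn_of_tendsto hA
  exact (hasFDerivAt_of_tendstoUniformlyOn isOpen_ball hU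
    (fun k y hy => (hdiff k y (hsub' hy)).hasFDerivAt)
    (fun y hy => hfg.tendsto_at (hsub' hy)) (mem_ball_self hr2)).differentiableAt

/-- Second-order Taylor estimate in one variable, from the Schwarz lemma. -/
theorem norm_sub_sub_le_of_bounded {g : ℂ → ℂ} {ρ M : ℝ} (hρ : 0 < ρ)
    (hg : DifferentiableOn ℂ g (ball 0 ρ)) (hM : ∀ t ∈ ball (0 : ℂ) ρ, ‖g t‖ ≤ M) {t : ℂ}
    (ht : t ∈ ball (0 : ℂ) ρ) : ‖g t - g 0 - t * deriv g 0‖ ≤ 4 * M * (‖t‖ / ρ) ^ 2 := by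
  have h0 : (0 : ℂ) ∈ ball (0 : ℂ) ρ := mem_ball_self hρ
  have hd0 : DifferentiableAt ℂ g 0 := hg.differentiableAt (isOpen_ball.mem_nhds h0)
  have h2 : ∀ s ∈ ball (0 : ℂ) ρ, ‖g s - g 0‖ ≤ 2 * M := fun s hs => by
    have := norm_sub_le (g s) (g 0)
    linarith [hM s hs, hM 0 h0]
  have hder : ‖deriv g 0‖ ≤ 2 * M / ρ :=
    Complex.norm_deriv_le_div_of_mapsTo_ball hg
      (fun s hs => by rw [mem_closedBall, dist_eq_norm]; exact h2 s hs) hρ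
  have hM0 : 0 ≤ M := (norm_nonneg _).trans (hM 0 h0)
  have key := Complex.dist_le_mul_div_pow_of_mapsTo_ball_of_isLittleO
    (f := fun s => g s - g 0 - s * deriv g 0) (c := 0) (z := t) (R₁ := ρ) (R₂ := 4 * M) (n := 1)
    ((hg.sub_const _).sub (by fun_prop)) ?_ ?_ ht
  · simpa [dist_eq_norm] using key
  · intro s hs
    rw [mem_closedBall, dist_eq_norm]
    simp only [sub_self, zero_mul, sub_zero]
    have h3 := norm_sub_le (g s - g 0) (s * deriv g 0)
    have h4 : ‖s * deriv g 0‖ ≤ 2 * M := by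
      rw [norm_mul]
      have hs' : ‖s‖ ≤ ρ := by simpa using (mem_ball.1 hs).le
      calc ‖s‖ * ‖deriv g 0‖ ≤ ρ * (2 * M / ρ) := by gcongr
        _ = 2 * M := by field_simp
    linarith [h2 s hs]
  · have := hasDerivAt_iff_isLittleO.1 hd0.hasDerivAt
    simpa using this.norm_right

/-- Directional derivatives of holomorphic functions of several variables are holomorphic: the
difference quotients converge locally uniformly. -/
theorem differentiableOn_fderiv_apply {f : E → ℂ} {U : Set E} (hU : IsOpen U)
    (hf : DifferentiableOn ℂ f U) (v : E) : DifferentiableOn ℂ (fun x => fderiv ℂ f x v) U := by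
  intro x hx
  refine DifferentiableAt.differentiableWithinAt ?_
  obtain ⟨r, hr, hball, M, hM⟩ : ∃ r > 0, ball x (2 * r) ⊆ U ∧
      ∃ M, ∀ y ∈ ball x (2 * r), ‖f y‖ ≤ M := by
    have hc : ContinuousAt f x := (hf.differentiableAt (hU.mem_nhds hx)).continuousAt
    have h1 : ∀ᶠ y in 𝓝 x, ‖f y‖ < ‖f x‖ + 1 :=
      hc.norm.eventually_lt continuousAt_const (by simp)
    obtain ⟨r, hr, h⟩ := Metric.mem_nhds_iff.1 (inter_mem h1 (hU.mem_nhds hx))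
    refine ⟨r / 2, by positivity, fun y hy => (h ?_).2, ‖f x‖ + 1, fun y hy => (h ?_).1.le⟩ <;>
    · convert hy using 2; ring
  have hM0 : 0 ≤ M := (norm_nonneg _).trans (hM x (mem_ball_self (by positivity)))
  -- small enough that the discs `y + t v`, `|t| < ρ`, centred in `ball x r` stay in `ball x (2 r)`
  set ρ : ℝ := r / (‖v‖ + 1) with hρdef
  have hρ : 0 < ρ := by positivity
  have hρv : ρ * ‖v‖ ≤ r := by
    rw [hρdef, div_mul_eq_mul_div, div_le_iff₀ (by positivity)]
    nlinarith [norm_nonneg v]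
  have hseg : ∀ y ∈ ball x r, ∀ t ∈ ball (0 : ℂ) ρ, y + t • v ∈ ball x (2 * r) := by
    intro y hy t ht
    rw [mem_ball, dist_eq_norm] at *
    calc ‖y + t • v - x‖ = ‖(y - x) + t • v‖ := by congr 1; abel
      _ ≤ ‖y - x‖ + ‖t‖ * ‖v‖ := (norm_add_le _ _).trans_eq (by rw [norm_smul])
      _ ≤ ‖y - x‖ + ρ * ‖v‖ := by
        gcongr; simpa using ht.le
      _ < 2 * r := by linarith
  have hdy : ∀ y ∈ ball x (2 * r), DifferentiableAt ℂ f y := fun y hy =>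
    hf.differentiableAt (hU.mem_nhds (hball hy))
  obtain ⟨N, hN⟩ := exists_nat_gt (1 / ρ)
  set t : ℕ → ℂ := fun k => 1 / ((k + N + 1 : ℕ) : ℂ) with ht
  have htn : ∀ k, ‖t k‖ = 1 / ((k + N + 1 : ℕ) : ℝ) := fun k => by
    rw [ht]; simp only [norm_div, norm_one, Complex.norm_natCast]
  have htpos : ∀ k, 0 < ‖t k‖ := fun k => by rw [htn]; positivity
  have ht0 : ∀ k, t k ≠ 0 := fun k => norm_pos_iff.1 (htpos k)
  have htρ : ∀ k, t k ∈ ball (0 : ℂ) ρ := fun k => by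
    rw [mem_ball_zero_iff, htn, one_div_lt (by positivity) hρ]
    push_cast; have : (0 : ℝ) ≤ k := Nat.cast_nonneg k
    linarith
  have htlim : Tendsto (fun k => ‖t k‖) atTop (𝓝 0) := by
    simp only [htn]
    have := tendsto_one_div_add_atTop_nhds_zero_nat (𝕜 := ℝ)
    refine ((tendsto_add_atTop_iff_nat N).2 this).congr fun k => ?_
    push_cast; ring
  refine differentiableAt_of_tendstoUniformlyOn (f := fun k y => (t k)⁻¹ * (f (y + t k • v) - f y))
    hr (fun k y hy => ?_) ?_
  · have h1 := hdy _ (hseg y hy (t k) (htρ k))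
    have h2 := hdy y (ball_subset_ball (by linarith) hy)
    refine DifferentiableAt.differentiableWithinAt ?_
    refine (DifferentiableAt.sub ?_ h2).const_mul _
    exact h1.comp y (f := fun y => y + t k • v) (by fun_prop)
  · rw [Metric.tendstoUniformlyOn_iff]
    intro ε hε
    have hlim : Tendsto (fun k => 4 * M / ρ ^ 2 * ‖t k‖) atTop (𝓝 0) := by
      simpa using htlim.const_mul (4 * M / ρ ^ 2)
    filter_upwards [hlim.eventually_lt_const hε] with k hk y hy
    refine lt_of_le_of_lt ?_ hk
    have hg : DifferentiableOn ℂ (fun s : ℂ => f (y + s • v)) (ball 0 ρ) := fun s hs =>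
      ((hdy _ (hseg y hy s hs)).comp s (f := fun s : ℂ => y + s • v)
        (by fun_prop)).differentiableWithinAt
    have key := norm_sub_sub_le_of_bounded hρ hg (fun s hs => hM _ (hseg y hy s hs)) (htρ k)
    have hder : deriv (fun s : ℂ => f (y + s • v)) 0 = fderiv ℂ f y v := by
      have h2 := (hdy y (ball_subset_ball (by linarith) hy)).hasFDerivAt
      have h3 : HasDerivAt (fun s : ℂ => y + s • v) v 0 := by
        simpa using ((hasDerivAt_id (0 : ℂ)).smul_const v).const_add y
      exact (HasFDerivAt.comp_hasDerivAt (f := fun s : ℂ => y + s • v) 0 (by simpa using h2)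
        h3).deriv
    rw [hder] at key
    simp only [zero_smul, add_zero] at key
    rw [dist_comm, dist_eq_norm]
    have : (t k)⁻¹ * (f (y + t k • v) - f y) - fderiv ℂ f y v
        = (t k)⁻¹ * (f (y + t k • v) - f y - t k * fderiv ℂ f y v) := by
      field_simp [ht0 k]
    rw [this, norm_mul, norm_inv]
    calc ‖t k‖⁻¹ * _ ≤ ‖t k‖⁻¹ * (4 * M * (‖t k‖ / ρ) ^ 2) := by gcongr
      _ = 4 * M / ρ ^ 2 * ‖t k‖ := by have := (htpos k).ne'; field_simp

/-- Differentiation in a distinguished complex variable preserves joint holomorphy. -/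
theorem differentiableOn_deriv_fst {f : ℂ × E → ℂ} {U : Set (ℂ × E)} (hU : IsOpen U)
    (hf : DifferentiableOn ℂ f U) :
    DifferentiableOn ℂ (fun x => deriv (fun s => f (s, x.2)) x.1) U := by
  refine (differentiableOn_fderiv_apply hU hf (1, 0)).congr fun x hx => ?_
  have h := (hf.differentiableAt (hU.mem_nhds hx)).hasFDerivAt
  have h2 : HasDerivAt (fun s : ℂ => (s, x.2)) ((1 : ℂ), (0 : E)) x.1 :=
    (hasDerivAt_id x.1).prodMk (hasDerivAt_const x.1 x.2)
  exact (HasFDerivAt.comp_hasDerivAt (f := fun s : ℂ => (s, x.2)) x.1 h h2).deriv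

end Holomorphic

/-! ### Complex linear changes of variables -/

section LinearChange

/-- Mathlib has this for `Measure.prod`; this is the same fact for `volume`. -/
theorem isAddHaarMeasure_volume_prod {A B : Type*} [AddGroup A] [TopologicalSpace A]
    [MeasureSpace A] [AddGroup B] [TopologicalSpace B] [MeasureSpace B]
    [(volume : Measure A).IsAddHaarMeasure] [(volume : Measure B).IsAddHaarMeasure]
    [SFinite (volume : Measure A)] [SFinite (volume : Measure B)]
    [MeasurableAdd A] [MeasurableAdd B] :
    (volume : Measure (A × B)).IsAddHaarMeasure :=
  inferInstanceAs (((volume : Measure A).prod (volume : Measure B)).IsAddHaarMeasure)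

variable {E : Type*} [NormedAddCommGroup E] [NormedSpace ℂ E] [FiniteDimensional ℂ E]
  [MeasureSpace E] [BorelSpace E] [(volume : Measure E).IsAddHaarMeasure]

/-- The real Jacobian of a complex linear map is the squared modulus of its determinant. -/
theorem map_volume_linearMap {L : E →ₗ[ℂ] E} (hL : LinearMap.det L ≠ 0) :
    Measure.map L (volume : Measure E) =
      ENNReal.ofReal ((‖LinearMap.det L‖ ^ 2)⁻¹) • (volume : Measure E) := by
  have : FiniteDimensional ℝ E := FiniteDimensional.complexToReal E
  have hdet : LinearMap.det (L.restrictScalars ℝ) = ‖LinearMap.det L‖ ^ 2 := by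
    rw [LinearMap.det_restrictScalars, Algebra.norm_complex_apply, Complex.normSq_eq_norm_sq]
  have h := Measure.map_linearMap_addHaar_eq_smul_addHaar (μ := (volume : Measure E))
    (f := L.restrictScalars ℝ) (by rw [hdet]; positivity)
  rw [hdet, abs_of_nonneg (by positivity)] at h
  exact h

theorem measurePreserving_smul_of_norm_eq_one {c : ℂ} (hc : ‖c‖ = 1) :
    MeasurePreserving (fun v : E => c • v) volume volume := by
  have hdet : ‖LinearMap.det (c • (LinearMap.id : E →ₗ[ℂ] E))‖ = 1 := by
    simp [hc]
  have h := map_volume_linearMap (E := E) (L := c • LinearMap.id)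
    (fun h => by rw [h, norm_zero] at hdet; exact zero_ne_one hdet)
  rw [hdet] at h
  refine ⟨(continuous_const_smul c).measurable, ?_⟩
  rw [one_pow, inv_one, ENNReal.ofReal_one, one_smul] at h
  exact h

end LinearChange

section Norm

variable {E : Type*} [MeasureSpace E]

/-- The norm of the Bergman space of `Ω`. -/
noncomputable def bergmanNorm (Ω : Set E) (f : E → ℂ) : ℝ :=
  (eLpNorm f 2 (volume.restrict Ω)).toReal

theorem bergmanNorm_nonneg (Ω : Set E) (f : E → ℂ) : 0 ≤ bergmanNorm Ω f := ENNReal.toReal_nonneg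

theorem integral_conj_mul_comm (Ω : Set E) (f g : E → ℂ) :
    ∫ ζ in Ω, conj (f ζ) * g ζ = conj (∫ ζ in Ω, conj (g ζ) * f ζ) := by
  rw [← integral_conj]
  congr 1 with ζ
  simp [mul_comm]

end Norm

/-! ### The mean value property and bounded evaluations -/

section MeanValue

variable {E : Type*} [NormedAddCommGroup E] [NormedSpace ℂ E] [FiniteDimensional ℂ E]
  [MeasureSpace E] [BorelSpace E] [(volume : Measure E).IsAddHaarMeasure]

theorem setIntegral_comp_smul_of_balanced {B : Set E} (hB : Balanced ℂ B)
    (g : E → ℂ) {c : ℂ} (hc : ‖c‖ = 1) : ∫ v in B, g (c • v) = ∫ v in B, g v := by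
  have hc0 : c ≠ 0 := norm_pos_iff.1 (hc ▸ one_pos)
  have hmp := measurePreserving_smul_of_norm_eq_one (E := E) hc
  have hpre : (fun v : E => c • v) ⁻¹' B = B := by
    ext v
    exact hB.smul_mem_iff (a := c) (b := 1) (by simp [hc]) |>.trans (by simp)
  have := hmp.setIntegral_preimage_emb
    (Homeomorph.smulOfNeZero c hc0).measurableEmbedding g B
  rwa [hpre] at this

/-- The mean value property over a translate of a balanced compact set: average over the
circles `θ ↦ p + e^{iθ} v`. -/
theorem setIntegral_eq_of_balanced {Ω B : Set E} (hΩ : IsOpen Ω) (hB : Balanced ℂ B)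
    (hBc : IsCompact B) {p : E} (hp : ∀ v ∈ B, p + v ∈ Ω) {f : E → ℂ}
    (hf : DifferentiableOn ℂ f Ω) : ∫ v in B, f (p + v) = volume.real B * f p := by
  have hBm : MeasurableSet B := hBc.measurableSet
  have hint : Integrable (fun x : E × ℝ => f (p + circleMap 0 1 x.2 • x.1))
      ((volume.restrict B).prod (volume.restrict (uIoc 0 (2 * Real.pi)))) := by
    rw [Measure.prod_restrict]
    have hc : ContinuousOn (fun x : E × ℝ => f (p + circleMap 0 1 x.2 • x.1))
        (B ×ˢ Icc 0 (2 * Real.pi)) := by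
      refine hf.continuousOn.comp (Continuous.continuousOn ?_) ?_
      · exact continuous_const.add (((continuous_circleMap 0 1).comp continuous_snd).smul
          continuous_fst)
      · rintro ⟨v, θ⟩ ⟨hv, -⟩
        exact hp _ (hB.smul_mem (by simp [circleMap]) hv)
    refine (hc.integrableOn_compact (hBc.prod isCompact_Icc)).mono_set ?_
    rw [uIoc_of_le (by positivity)]
    exact prod_mono le_rfl Ioc_subset_Icc_self
  have hswap := integral_integral_swap (f := fun v (θ : ℝ) => f (p + circleMap 0 1 θ • v)) hint
  have h1 : ∀ v ∈ B, ∫ θ in uIoc 0 (2 * Real.pi), f (p + circleMap 0 1 θ • v)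
      = (2 * Real.pi : ℝ) * f p := by
    intro v hv
    have hd : DiffContOnCl ℂ (fun t : ℂ => f (p + t • v)) (ball 0 |1|) := by
      refine DifferentiableOn.diffContOnCl (fun t ht => ?_)
      rw [closure_ball _ (by simp)] at ht
      have hmem : p + t • v ∈ Ω := hp _ (hB.smul_mem (by simpa using ht) hv)
      exact ((hf.differentiableAt (hΩ.mem_nhds hmem)).comp t (f := fun t : ℂ => p + t • v)
        (by fun_prop)).differentiableWithinAt
    have := hd.circleAverage
    rw [Real.circleAverage_def, intervalIntegral.intervalIntegral_eq_integral_uIoc] at this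
    simp only [if_pos (show (0 : ℝ) ≤ 2 * Real.pi by positivity), one_smul, zero_smul,
      add_zero] at this
    rw [← this, Complex.real_smul, ← mul_assoc]
    have hpi : (Real.pi : ℂ) ≠ 0 := by exact_mod_cast Real.pi_ne_zero
    push_cast
    field_simp
  have h2 : ∀ θ : ℝ, ∫ v in B, f (p + circleMap 0 1 θ • v) = ∫ v in B, f (p + v) := fun θ =>
    setIntegral_comp_smul_of_balanced hB (fun v => f (p + v)) (by simp [circleMap])
  simp only [h2] at hswap
  rw [setIntegral_congr_fun hBm h1] at hswap
  simp only [integral_const, measureReal_restrict_apply_univ, uIoc_of_le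
    (show (0 : ℝ) ≤ 2 * Real.pi by positivity), Real.volume_real_Ioc, sub_zero,
    max_eq_left (show (0 : ℝ) ≤ 2 * Real.pi by positivity), Complex.real_smul] at hswap
  have hpi : ((2 * Real.pi : ℝ) : ℂ) ≠ 0 := by exact_mod_cast (by positivity)
  apply mul_left_cancel₀ hpi
  rw [← hswap]; ring

/-- The sub-mean value inequality, over a translate of a balanced compact set. -/
theorem norm_mul_sqrt_le_bergmanNorm {Ω B : Set E} (hΩ : IsOpen Ω) (hB : Balanced ℂ B)
    (hBc : IsCompact B) {p : E} (hp : ∀ v ∈ B, p + v ∈ Ω) {f : E → ℂ}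
    (hf : f ∈ bergmanSpace Ω) : ‖f p‖ * √(volume.real B) ≤ bergmanNorm Ω f := by
  have hmean := setIntegral_eq_of_balanced hΩ hB hBc hp hf.1
  have hmp : MeasurePreserving (fun v : E => p + v) (volume.restrict ((fun v => p + v) ⁻¹' Ω))
      (volume.restrict Ω) :=
    (measurePreserving_add_left volume p).restrict_preimage hΩ.measurableSet
  have hsub : B ⊆ (fun v => p + v) ⁻¹' Ω := hp
  have hcomp : AEStronglyMeasurable (fun v => f (p + v))
      (volume.restrict ((fun v => p + v) ⁻¹' Ω)) := hf.2.1.comp_measurePreserving hmp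
  have h1 : eLpNorm (fun v => f (p + v)) 2 (volume.restrict B)
      ≤ eLpNorm f 2 (volume.restrict Ω) := by
    rw [← eLpNorm_comp_measurePreserving hf.2.1 hmp]
    exact eLpNorm_mono_measure _ (Measure.restrict_mono hsub le_rfl)
  have h2 := eLpNorm_le_eLpNorm_mul_rpow_measure_univ (p := 1) (q := 2) (by norm_num)
    (hcomp.mono_measure (Measure.restrict_mono hsub le_rfl))
  have h3 : ‖∫ v in B, f (p + v)‖ₑ ≤ eLpNorm (fun v => f (p + v)) 1 (volume.restrict B) := by
    rw [eLpNorm_one_eq_lintegral_enorm]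
    exact enorm_integral_le_lintegral_enorm _
  have hBfin : volume B ≠ ⊤ := hBc.measure_lt_top.ne
  have h4 : ‖∫ v in B, f (p + v)‖ₑ
      ≤ eLpNorm f 2 (volume.restrict Ω) * volume B ^ (1 / 2 : ℝ) := by
    refine h3.trans (h2.trans ?_)
    rw [Measure.restrict_apply_univ]
    norm_num
    gcongr
  have h5 := ENNReal.toReal_mono
    (ENNReal.mul_ne_top hf.2.2.ne (ENNReal.rpow_ne_top_of_nonneg (by norm_num) hBfin)) h4
  rw [toReal_enorm, hmean, norm_mul, ENNReal.toReal_mul, ← ENNReal.toReal_rpow,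
    Complex.norm_real, Real.norm_of_nonneg measureReal_nonneg, ← Real.sqrt_eq_rpow] at h5
  change volume.real B * ‖f p‖ ≤ bergmanNorm Ω f * √(volume.real B) at h5
  rcases (measureReal_nonneg (μ := (volume : Measure E)) (s := B)).eq_or_lt with h0 | h0
  · rw [← h0]; simpa using bergmanNorm_nonneg Ω f
  · have hs : 0 < √(volume.real B) := Real.sqrt_pos.2 h0
    refine le_of_mul_le_mul_right ?_ hs
    rw [mul_assoc, Real.mul_self_sqrt h0.le]
    linarith

/-- Point evaluations are bounded on the Bergman space, uniformly on compact sets. -/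
theorem exists_norm_le_bergmanNorm {Ω K : Set E} (hΩ : IsOpen Ω) (hK : IsCompact K)
    (hKΩ : K ⊆ Ω) :
    ∃ C, 0 ≤ C ∧ ∀ p ∈ K, ∀ f ∈ bergmanSpace Ω, ‖f p‖ ≤ C * bergmanNorm Ω f := by
  have : ProperSpace E := FiniteDimensional.proper ℂ E
  obtain ⟨δ, hδ, hsub⟩ := hK.exists_cthickening_subset_open hΩ hKΩ
  have hpos : 0 < volume.real (closedBall (0 : E) δ) :=
    ENNReal.toReal_pos (measure_closedBall_pos _ _ hδ).ne' measure_closedBall_lt_top.ne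
  refine ⟨(√(volume.real (closedBall (0 : E) δ)))⁻¹, by positivity, fun p hp f hf => ?_⟩
  have h := norm_mul_sqrt_le_bergmanNorm hΩ (balanced_closedBall_zero (𝕜 := ℂ))
    (isCompact_closedBall (0 : E) δ) (p := p) (fun v hv => hsub ?_) hf
  · rw [inv_mul_eq_div, le_div_iff₀ (Real.sqrt_pos.2 hpos)]
    exact h
  · refine mem_cthickening_of_dist_le (p + v) p δ _ hp ?_
    simpa [dist_eq_norm] using hv

end MeanValue

/-! ### Completeness and the Riesz theorem -/

section Riesz

variable {E : Type*} [NormedAddCommGroup E] [NormedSpace ℂ E] [MeasureSpace E]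

theorem add_mem_bergmanSpace {Ω : Set E} {f g : E → ℂ} (hf : f ∈ bergmanSpace Ω)
    (hg : g ∈ bergmanSpace Ω) : f + g ∈ bergmanSpace Ω := ⟨hf.1.add hg.1, hf.2.add hg.2⟩

theorem sub_mem_bergmanSpace {Ω : Set E} {f g : E → ℂ} (hf : f ∈ bergmanSpace Ω)
    (hg : g ∈ bergmanSpace Ω) : f - g ∈ bergmanSpace Ω := ⟨hf.1.sub hg.1, hf.2.sub hg.2⟩

theorem smul_mem_bergmanSpace {Ω : Set E} {f : E → ℂ} (c : ℂ) (hf : f ∈ bergmanSpace Ω) :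
    c • f ∈ bergmanSpace Ω := ⟨hf.1.const_smul c, hf.2.const_smul c⟩

/-- The Bergman space as a subspace of `L²(Ω)`: the classes with a holomorphic representative. -/
def bergmanSubmodule (Ω : Set E) : Submodule ℂ (Lp ℂ 2 (volume.restrict Ω : Measure E)) where
  carrier := {F | ∃ f : E → ℂ, DifferentiableOn ℂ f Ω ∧ F =ᵐ[volume.restrict Ω] f}
  zero_mem' := ⟨0, differentiableOn_const 0, Lp.coeFn_zero _ _ _⟩
  add_mem' := by
    rintro F G ⟨f, hf, hF⟩ ⟨g, hg, hG⟩
    exact ⟨f + g, hf.add hg, (Lp.coeFn_add F G).trans (hF.add hG)⟩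
  smul_mem' := by
    rintro c F ⟨f, hf, hF⟩
    exact ⟨c • f, hf.const_smul c, (Lp.coeFn_smul c F).trans (hF.const_smul c)⟩

theorem exists_rep_of_mem_bergmanSubmodule {Ω : Set E}
    {F : Lp ℂ 2 (volume.restrict Ω : Measure E)}
    (hF : F ∈ bergmanSubmodule Ω) : ∃ f ∈ bergmanSpace Ω, F =ᵐ[volume.restrict Ω] f := by
  obtain ⟨f, hf, h⟩ := hF
  exact ⟨f, ⟨hf, (memLp_congr_ae h).1 (Lp.memLp F)⟩, h⟩

variable [FiniteDimensional ℂ E] [BorelSpace E] [(volume : Measure E).IsAddHaarMeasure]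

/-- `L²` limits of holomorphic functions are holomorphic. -/
theorem isClosed_bergmanSubmodule {Ω : Set E} (hΩ : IsOpen Ω) :
    IsClosed (bergmanSubmodule Ω : Set (Lp ℂ 2 (volume.restrict Ω : Measure E))) := by
  have : ProperSpace E := FiniteDimensional.proper ℂ E
  refine IsSeqClosed.isClosed fun F F₀ hF hlim => ?_
  choose f hf hFf using fun k => exists_rep_of_mem_bergmanSubmodule (hF k)
  have hnorm : ∀ k l, bergmanNorm Ω (f k - f l) = dist (F k) (F l) := fun k l => by
    rw [dist_eq_norm, Lp.norm_def, bergmanNorm]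
    congr 1
    exact eLpNorm_congr_ae (((hFf k).sub (hFf l)).symm.trans (Lp.coeFn_sub _ _).symm)
  have hcauchy : ∀ K ⊆ Ω, IsCompact K → UniformCauchySeqOn f atTop K := by
    intro K hKΩ hK
    obtain ⟨C, hC0, hC⟩ := exists_norm_le_bergmanNorm hΩ hK hKΩ
    rw [Metric.uniformCauchySeqOn_iff]
    intro ε hε
    obtain ⟨N, hN⟩ := Metric.cauchySeq_iff.1 hlim.cauchySeq (ε / (C + 1)) (by positivity)
    refine ⟨N, fun k hk l hl x hx => ?_⟩
    have h1 := hC x hx _ (sub_mem_bergmanSpace (hf k) (hf l))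
    rw [hnorm] at h1
    have h2 := hN k hk l hl
    rw [lt_div_iff₀ (by positivity)] at h2
    rw [dist_eq_norm]
    have h3 : (0 : ℝ) ≤ dist (F k) (F l) := dist_nonneg
    have : ‖f k x - f l x‖ ≤ C * dist (F k) (F l) := h1
    nlinarith
  have hex : ∀ x ∈ Ω, ∃ y, Tendsto (fun k => f k x) atTop (𝓝 y) := fun x hx =>
    cauchySeq_tendsto_of_complete
      ((hcauchy {x} (singleton_subset_iff.2 hx) isCompact_singleton).cauchySeq (mem_singleton x))
  choose! g hg using hex
  refine ⟨g, fun x hx => ?_, ?_⟩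
  · obtain ⟨r, hr, hball⟩ := nhds_basis_closedBall.mem_iff.1 (hΩ.mem_nhds hx)
    have hsub : ball x r ⊆ Ω := ball_subset_closedBall.trans hball
    refine (differentiableAt_of_tendstoUniformlyOn hr (fun k => (hf k).1.mono hsub)
      (UniformCauchySeqOn.tendstoUniformlyOn_of_tendsto
      ((hcauchy _ hball (isCompact_closedBall x r)).mono ball_subset_closedBall)
      fun y hy => hg y (hsub hy))).differentiableWithinAt
  · obtain ⟨φ, hφ, hae⟩ := (tendstoInMeasure_of_tendsto_Lp hlim).exists_seq_tendsto_ae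
    filter_upwards [hae, ae_all_iff.2 hFf, ae_restrict_mem hΩ.measurableSet] with x h1 h2 h3
    refine tendsto_nhds_unique h1 ?_
    simp only [h2]
    exact (hg x h3).comp hφ.tendsto_atTop

/-- The Riesz theorem in the Bergman space. -/
theorem exists_riesz_bergmanSpace {Ω : Set E} (hΩ : IsOpen Ω) {L : (E → ℂ) → ℂ} {C : ℝ}
    (hadd : ∀ f ∈ bergmanSpace Ω, ∀ g ∈ bergmanSpace Ω, L (f + g) = L f + L g)
    (hsmul : ∀ c : ℂ, ∀ f ∈ bergmanSpace Ω, L (c • f) = c * L f)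
    (hC : 0 ≤ C) (hbound : ∀ f ∈ bergmanSpace Ω, ‖L f‖ ≤ C * bergmanNorm Ω f) :
    ∃ b ∈ bergmanSpace Ω, bergmanNorm Ω b ≤ C ∧
      ∀ f ∈ bergmanSpace Ω, L f = ∫ ζ in Ω, conj (b ζ) * f ζ := by
  -- by boundedness `L` depends only on the class in `L²`
  have hcongr : ∀ f ∈ bergmanSpace Ω, ∀ g ∈ bergmanSpace Ω, f =ᵐ[volume.restrict Ω] g →
      L f = L g := by
    intro f hf g hg hfg
    have h1 : L f = L (f - g) + L g := by
      rw [← hadd _ (sub_mem_bergmanSpace hf hg) _ hg, sub_add_cancel]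
    have h2 := hbound _ (sub_mem_bergmanSpace hf hg)
    have h3 : bergmanNorm Ω (f - g) = 0 := by
      rw [bergmanNorm, eLpNorm_congr_ae (g := 0) (by filter_upwards [hfg] with x hx; simp [hx])]
      simp
    rw [h3, mul_zero, norm_le_zero_iff] at h2
    rw [h1, h2, zero_add]
  let S := bergmanSubmodule Ω
  have : CompleteSpace S := (isClosed_bergmanSubmodule hΩ).completeSpace_coe
  choose r hr hFr using fun F : S => exists_rep_of_mem_bergmanSubmodule F.2
  let ℓ₀ : S →ₗ[ℂ] ℂ :=
    { toFun := fun F => L (r F)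
      map_add' := fun F G => by
        rw [← hadd _ (hr F) _ (hr G)]
        refine hcongr _ (hr _) _ (add_mem_bergmanSpace (hr F) (hr G)) ?_
        exact (hFr (F + G)).symm.trans ((Lp.coeFn_add _ _).trans ((hFr F).add (hFr G)))
      map_smul' := fun c F => by
        rw [RingHom.id_apply, smul_eq_mul, ← hsmul c _ (hr F)]
        refine hcongr _ (hr _) _ (smul_mem_bergmanSpace c (hr F)) ?_
        exact (hFr (c • F)).symm.trans ((Lp.coeFn_smul _ _).trans ((hFr F).const_smul c)) }
  let ℓ : S →L[ℂ] ℂ := ℓ₀.mkContinuous C fun F => by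
    refine (hbound _ (hr F)).trans_eq ?_
    rw [bergmanNorm, ← eLpNorm_congr_ae (hFr F)]
    rfl
  have hℓ : ‖ℓ‖ ≤ C := LinearMap.mkContinuous_norm_le _ hC _
  let b := (InnerProductSpace.toDual ℂ S).symm ℓ
  refine ⟨r b, hr b, ?_, fun f hf => ?_⟩
  · rw [bergmanNorm, ← eLpNorm_congr_ae (hFr b)]
    change ‖b‖ ≤ C
    rwa [LinearIsometryEquiv.norm_map]
  · let F : S := ⟨hf.2.toLp f, f, hf.1, hf.2.coeFn_toLp⟩
    have hF : (F : Lp ℂ 2 (volume.restrict Ω : Measure E)) =ᵐ[volume.restrict Ω] f :=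
      hf.2.coeFn_toLp
    have h1 : inner ℂ b F = L (r F) := InnerProductSpace.toDual_symm_apply
    rw [hcongr f hf _ (hr F) (hF.symm.trans (hFr F)), ← h1, Submodule.coe_inner, L2.inner_def]
    refine integral_congr_ae ?_
    filter_upwards [hFr b, hF] with x h2 h3
    rw [h2, h3, RCLike.inner_apply, mul_comm]

end Riesz

/-! ### The Bergman kernel -/

section Kernel

variable {E : Type*} [NormedAddCommGroup E] [NormedSpace ℂ E] [MeasureSpace E]

theorem integrable_conj_mul_of_mem_bergmanSpace {Ω : Set E} {f g : E → ℂ}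
    (hf : f ∈ bergmanSpace Ω) (hg : g ∈ bergmanSpace Ω) :
    Integrable (fun ζ => conj (f ζ) * g ζ) (volume.restrict Ω) :=
  MemLp.integrable_mul hf.2.star hg.2

/-- The Hermitian symmetry of the kernel. -/
theorem IsRepresenter.conj_apply {Ω : Set E} {p q : E} {k l : E → ℂ}
    (hk : IsRepresenter Ω p k) (hl : IsRepresenter Ω q l) : conj (k q) = l p := by
  rw [hl.2 k hk.1, hk.2 l hl.1, integral_conj_mul_comm, Complex.conj_conj]

variable [FiniteDimensional ℂ E] [BorelSpace E] [(volume : Measure E).IsAddHaarMeasure]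

theorem exists_isRepresenter {Ω : Set E} (hΩ : IsOpen Ω) {p : E} (hp : p ∈ Ω) :
    ∃ k, IsRepresenter Ω p k := by
  obtain ⟨C, hC0, hC⟩ := exists_norm_le_bergmanNorm hΩ isCompact_singleton
    (singleton_subset_iff.2 hp)
  obtain ⟨b, hb, -, h⟩ := exists_riesz_bergmanSpace hΩ (L := fun f => f p)
    (fun _ _ _ _ => rfl) (fun _ _ _ => rfl) hC0 (hC p (mem_singleton p))
  exact ⟨b, hb, h⟩

/-- The kernel, as a function of its first variable, is the representer of evaluation at its
second variable. -/
theorem bergmanKernel_eq {Ω : Set E} (hΩ : IsOpen Ω) {p q : E} (hp : p ∈ Ω)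
    {k : E → ℂ} (hk : IsRepresenter Ω q k) : bergmanKernel Ω p q = k p := by
  have h := exists_isRepresenter hΩ hp
  rw [bergmanKernel, dif_pos h]
  exact h.choose_spec.conj_apply hk

end Kernel

/-! ### The flow and its Jacobian -/

section Scaling

variable {n m : ℕ}

instance isAddHaarMeasure_volume_base :
    (volume : Measure ((Fin n → ℂ) × (Fin m → ℂ))).IsAddHaarMeasure :=
  isAddHaarMeasure_volume_prod

instance isAddHaarMeasure_volume_total :
    (volume : Measure (((Fin n → ℂ) × (Fin m → ℂ)) × ℂ)).IsAddHaarMeasure :=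
  isAddHaarMeasure_volume_prod

/-- The flow `σ_s(z, z') = ((e^{γ_j s} z_j)_j, z')`, with complex time `s`. -/
noncomputable def scale (γ : Fin n → ℝ) (s : ℂ) (p : (Fin n → ℂ) × (Fin m → ℂ)) :
    (Fin n → ℂ) × (Fin m → ℂ) :=
  (fun j => Complex.exp (γ j * s) * p.1 j, p.2)

theorem scale_zero (γ : Fin n → ℝ) (p : (Fin n → ℂ) × (Fin m → ℂ)) : scale γ 0 p = p := by
  simp [scale]

theorem scale_scale (γ : Fin n → ℝ) (s t : ℂ) (p : (Fin n → ℂ) × (Fin m → ℂ)) :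
    scale γ s (scale γ t p) = scale γ (s + t) p := by
  simp only [scale, mul_add, Complex.exp_add, mul_assoc]

theorem scale_neg_scale (γ : Fin n → ℝ) (s : ℂ) (p : (Fin n → ℂ) × (Fin m → ℂ)) :
    scale γ (-s) (scale γ s p) = p := by
  rw [scale_scale, neg_add_cancel, scale_zero]

theorem scale_scale_neg (γ : Fin n → ℝ) (s : ℂ) (p : (Fin n → ℂ) × (Fin m → ℂ)) :
    scale γ s (scale γ (-s) p) = p := by
  rw [scale_scale, add_neg_cancel, scale_zero]

theorem differentiable_scale (γ : Fin n → ℝ) :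
    Differentiable ℂ (fun x : ℂ × ((Fin n → ℂ) × (Fin m → ℂ)) => scale γ x.1 x.2) := by
  unfold scale
  refine Differentiable.prodMk (differentiable_pi.2 fun j => ?_) (by fun_prop)
  fun_prop

theorem differentiable_scale_left (γ : Fin n → ℝ) (p : (Fin n → ℂ) × (Fin m → ℂ)) :
    Differentiable ℂ (fun s => scale γ s p) :=
  (differentiable_scale γ).comp (differentiable_id.prodMk (differentiable_const p))

theorem differentiable_scale_right (γ : Fin n → ℝ) (s : ℂ) :
    Differentiable ℂ (fun p : (Fin n → ℂ) × (Fin m → ℂ) => scale γ s p) :=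
  (differentiable_scale γ).comp ((differentiable_const s).prodMk differentiable_id)

/-- The homeomorphism given by the flow at time `s`. -/
noncomputable def scaleHomeomorph (γ : Fin n → ℝ) (s : ℂ) :
    ((Fin n → ℂ) × (Fin m → ℂ)) ≃ₜ ((Fin n → ℂ) × (Fin m → ℂ)) where
  toFun := scale γ s
  invFun := scale γ (-s)
  left_inv := scale_neg_scale γ s
  right_inv := scale_scale_neg γ s
  continuous_toFun := (differentiable_scale_right γ s).continuous
  continuous_invFun := (differentiable_scale_right γ (-s)).continuous

theorem map_volume_scale (γ : Fin n → ℝ) (s : ℂ) :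
    Measure.map (scale γ s) (volume : Measure ((Fin n → ℂ) × (Fin m → ℂ))) =
      ENNReal.ofReal (Real.exp (-2 * (∑ j, γ j) * s.re)) • volume := by
  let L : ((Fin n → ℂ) × (Fin m → ℂ)) →ₗ[ℂ] ((Fin n → ℂ) × (Fin m → ℂ)) :=
    LinearMap.prodMap (LinearMap.pi fun j =>
      (Complex.exp (γ j * s) • LinearMap.id : ℂ →ₗ[ℂ] ℂ).comp (LinearMap.proj j)) LinearMap.id
  have hL : (L : _ → _) = scale γ s := by
    ext p j <;> simp [L, scale]
  have hdet : LinearMap.det L = Complex.exp ((∑ j, γ j : ℝ) * s) := by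
    simp only [L]
    rw [LinearMap.det_prodMap, LinearMap.det_pi, LinearMap.det_id, mul_one]
    simp only [LinearMap.det_smul, Module.finrank_self, pow_one, LinearMap.det_id, mul_one]
    rw [← Complex.exp_sum, ← Finset.sum_mul]
    push_cast; rfl
  have h := map_volume_linearMap (L := L) (by rw [hdet]; exact Complex.exp_ne_zero _)
  rw [hL, hdet, Complex.norm_exp, ← Real.exp_nat_mul, ← Real.exp_neg] at h
  rw [h]
  congr 3
  simp
  ring

theorem setIntegral_comp_scale (γ : Fin n → ℝ) (s : ℂ) (G : Set ((Fin n → ℂ) × (Fin m → ℂ)))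
    (g : (Fin n → ℂ) × (Fin m → ℂ) → ℂ) :
    ∫ p in scale γ s ⁻¹' G, g (scale γ s p) =
      (Real.exp (-2 * (∑ j, γ j) * s.re) : ℂ) * ∫ p in G, g p := by
  have h := (scaleHomeomorph (m := m) γ s).measurableEmbedding.setIntegral_map
    (μ := volume) g G
  change ∫ y in G, g y ∂(Measure.map (scale γ s) volume) = _ at h
  rw [map_volume_scale, Measure.restrict_smul, integral_smul_measure,
    ENNReal.toReal_ofReal (Real.exp_pos _).le, Complex.real_smul] at h
  exact h.symm

theorem setLIntegral_comp_scale (γ : Fin n → ℝ) (s : ℂ)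
    (G : Set ((Fin n → ℂ) × (Fin m → ℂ)))
    (g : (Fin n → ℂ) × (Fin m → ℂ) → ENNReal) :
    ∫⁻ p in scale γ s ⁻¹' G, g (scale γ s p) =
      ENNReal.ofReal (Real.exp (-2 * (∑ j, γ j) * s.re)) * ∫⁻ p in G, g p := by
  have h := (scaleHomeomorph (m := m) γ s).measurableEmbedding
  have h1 := h.lintegral_map (μ := volume.restrict (scale γ s ⁻¹' G)) g
  have h2 := h.restrict_map volume G
  change _ = Measure.map (scaleHomeomorph γ s) (volume.restrict (scale γ s ⁻¹' G)) at h2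
  rw [← h2] at h1
  change ∫⁻ y, g y ∂((Measure.map (scale γ s) volume).restrict G) = _ at h1
  rw [map_volume_scale, Measure.restrict_smul, lintegral_smul_measure] at h1
  exact h1.symm

theorem comp_scale_mem_bergmanSpace (γ : Fin n → ℝ) (s : ℂ)
    {G : Set ((Fin n → ℂ) × (Fin m → ℂ))} {f : (Fin n → ℂ) × (Fin m → ℂ) → ℂ}
    (hf : f ∈ bergmanSpace G) :
    (fun p => f (scale γ s p)) ∈ bergmanSpace (scale γ s ⁻¹' G) := by
  refine ⟨hf.1.comp (differentiable_scale_right γ s).differentiableOn fun p hp => hp, ?_⟩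
  have h := (scaleHomeomorph (m := m) γ s).measurableEmbedding
  have h1 := h.memLp_map_measure_iff (μ := volume.restrict (scale γ s ⁻¹' G)) (g := f) (p := 2)
  have h2 := h.restrict_map volume G
  change _ = Measure.map (scaleHomeomorph γ s) (volume.restrict (scale γ s ⁻¹' G)) at h2
  rw [← h2] at h1
  change MemLp f 2 ((Measure.map (scale γ s) volume).restrict G) ↔ _ at h1
  rw [map_volume_scale, Measure.restrict_smul] at h1
  exact h1.1 (hf.2.smul_measure ENNReal.ofReal_ne_top)

end Scaling

/-! ### Symmetry of the kernel under the flow -/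

section StarShaped

variable {n m : ℕ} {γ : Fin n → ℝ} {G : Set ((Fin n → ℂ) × (Fin m → ℂ))}

/-- Invariance under contraction of the first `n` coordinates (the third condition in
`IsStarShapedHartogs`). -/
def IsPolydiscStable (G : Set ((Fin n → ℂ) × (Fin m → ℂ))) : Prop :=
  ∀ z z', (z, z') ∈ G → ∀ c : Fin n → ℂ, (∀ j, ‖c j‖ ≤ 1) → ((fun j => c j * z j), z') ∈ G

theorem IsPolydiscStable.scale_mem (hG : IsPolydiscStable G) (hγ : ∀ j, 0 < γ j) {s : ℂ}
    (hs : s.re ≤ 0) {p : (Fin n → ℂ) × (Fin m → ℂ)} (hp : p ∈ G) : scale γ s p ∈ G := by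
  refine hG p.1 p.2 hp _ fun j => ?_
  rw [Complex.norm_exp, Real.exp_le_one_iff]
  simpa using mul_nonpos_of_nonneg_of_nonpos (hγ j).le hs

theorem IsPolydiscStable.scale_mem_of_re_le (hG : IsPolydiscStable G) (hγ : ∀ j, 0 < γ j) {s t : ℂ}
    (hst : s.re ≤ t.re) {p : (Fin n → ℂ) × (Fin m → ℂ)} (hp : scale γ t p ∈ G) :
    scale γ s p ∈ G := by
  have := hG.scale_mem hγ (s := s - t) (by simpa using hst) hp
  rwa [scale_scale, sub_add_cancel] at this

theorem IsPolydiscStable.exists_scale_mem (hG : IsPolydiscStable G) (hGo : IsOpen G)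
    (hγ : ∀ j, 0 < γ j) {p : (Fin n → ℂ) × (Fin m → ℂ)} (hp : p ∈ G) :
    ∃ δ > 0, ∀ s : ℂ, s.re < δ → scale γ s p ∈ G := by
  have hc : ContinuousAt (fun s => scale γ s p) 0 :=
    (differentiable_scale_left γ p).continuous.continuousAt
  have hmem : (fun s => scale γ s p) ⁻¹' G ∈ 𝓝 0 :=
    hc.preimage_mem_nhds (hGo.mem_nhds (by simpa [scale_zero] using hp))
  obtain ⟨δ, hδ, hball⟩ := Metric.mem_nhds_iff.1 hmem
  refine ⟨δ / 2, by positivity, fun s hs => ?_⟩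
  refine hG.scale_mem_of_re_le hγ (t := ((δ / 2 : ℝ) : ℂ)) (by simpa using hs.le) ?_
  refine hball (a := ((δ / 2 : ℝ) : ℂ)) ?_
  rw [mem_ball_zero_iff, Complex.norm_real, Real.norm_of_nonneg (by positivity)]
  linarith

theorem isPolydiscStable_preimage_scale (hG : IsPolydiscStable G) (s : ℂ) :
    IsPolydiscStable (scale γ s ⁻¹' G) := by
  intro z z' hz c hc
  have := hG _ _ hz c hc
  simp only [mem_preimage, scale] at this ⊢
  convert this using 3
  ring

theorem isOpen_preimage_scale (hG : IsOpen G) (s : ℂ) : IsOpen (scale γ s ⁻¹' G) :=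
  hG.preimage (differentiable_scale_right γ s).continuous

theorem IsPolydiscStable.preimage_scale_of_re_eq_zero (hG : IsPolydiscStable G) (hγ : ∀ j, 0 < γ j)
    {s : ℂ} (hs : s.re = 0) : scale γ s ⁻¹' G = G := by
  ext p
  refine ⟨fun h => ?_, fun h => hG.scale_mem hγ hs.le h⟩
  have := hG.scale_mem hγ (s := -s) (by simp [hs]) h
  rwa [scale_neg_scale] at this

/-- Rotations act unitarily on the Bergman space, which moves them from one argument of the
kernel to the other. -/
theorem IsRepresenter.apply_scale_of_re_eq_zero (hG : IsPolydiscStable G)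
    (hγ : ∀ j, 0 < γ j) {p q : (Fin n → ℂ) × (Fin m → ℂ)}
    {k l : (Fin n → ℂ) × (Fin m → ℂ) → ℂ} (hk : IsRepresenter G q k)
    (hl : IsRepresenter G p l) {s : ℂ} (hs : s.re = 0) :
    k (scale γ s p) = conj (l (scale γ (conj s) q)) := by
  have hconj : conj s = -s := by
    apply Complex.ext <;> simp [hs]
  have hrep : IsRepresenter G (scale γ (-s) q) (fun u => k (scale γ s u)) := by
    refine ⟨?_, fun f hf => ?_⟩
    · have := comp_scale_mem_bergmanSpace γ s hk.1
      rwa [hG.preimage_scale_of_re_eq_zero hγ hs] at this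
    · have hf' := comp_scale_mem_bergmanSpace γ (-s) hf
      rw [hG.preimage_scale_of_re_eq_zero hγ (s := -s) (by simp [hs])] at hf'
      have h1 := hk.2 _ hf'
      have h2 := setIntegral_comp_scale γ s G (fun u => conj (k u) * f (scale γ (-s) u))
      rw [hG.preimage_scale_of_re_eq_zero hγ hs, hs] at h2
      simp only [mul_zero, Real.exp_zero, Complex.ofReal_one, one_mul, scale_neg_scale] at h2
      rw [h1, h2]
  rw [hconj, hl.conj_apply hrep]

/-- The identity principle extends the symmetry from rotations to contractions. -/
theorem IsRepresenter.apply_scale (hGo : IsOpen G) (hG : IsPolydiscStable G)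
    (hγ : ∀ j, 0 < γ j) {p q : (Fin n → ℂ) × (Fin m → ℂ)} (hp : p ∈ G) (hq : q ∈ G)
    {k l : (Fin n → ℂ) × (Fin m → ℂ) → ℂ} (hk : IsRepresenter G q k)
    (hl : IsRepresenter G p l) {s : ℂ} (hs : s.re ≤ 0) :
    k (scale γ s p) = conj (l (scale γ (conj s) q)) := by
  obtain ⟨δ₁, hδ₁, h₁⟩ := hG.exists_scale_mem hGo hγ hp
  obtain ⟨δ₂, hδ₂, h₂⟩ := hG.exists_scale_mem hGo hγ hq
  set U : Set ℂ := {s | s.re < min δ₁ δ₂} with hU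
  have hUo : IsOpen U := isOpen_lt Complex.continuous_re continuous_const
  have hUc : IsPreconnected U := (convex_halfSpace_re_lt _).isPreconnected
  have hd1 : DifferentiableOn ℂ (fun s => k (scale γ s p)) U :=
    hk.1.1.comp (differentiable_scale_left γ p).differentiableOn fun t ht =>
      h₁ t (lt_of_lt_of_le ht (min_le_left _ _))
  have hd2 : DifferentiableOn ℂ (fun s => conj (l (scale γ (conj s) q))) U := by
    intro t ht
    have hmem : scale γ (conj t) q ∈ G :=
      h₂ _ (by rw [Complex.conj_re]; exact lt_of_lt_of_le ht (min_le_right _ _))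
    have h := (hl.1.1.differentiableAt (hGo.mem_nhds hmem)).comp (conj t)
      (differentiable_scale_left γ q _)
    have h3 := h.conj_conj
    rw [Complex.conj_conj] at h3
    exact h3.differentiableWithinAt
  refine (hd1.analyticOnNhd hUo).eqOn_of_preconnected_of_frequently_eq
    (hd2.analyticOnNhd hUo) hUc (z₀ := 0) (by simp [hU, hδ₁, hδ₂]) ?_
    (by simp only [hU, mem_ofPred_eq]; exact hs.trans_lt (lt_min hδ₁ hδ₂))
  -- the imaginary axis accumulates at `0`
  have hlim : Tendsto (fun θ : ℝ => (θ : ℂ) * Complex.I) (𝓝[≠] 0) (𝓝[≠] 0) := by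
    refine tendsto_nhdsWithin_iff.2 ⟨?_, ?_⟩
    · have : Continuous fun θ : ℝ => (θ : ℂ) * Complex.I := by fun_prop
      exact (by simpa using this.tendsto 0 : Tendsto _ (𝓝 (0 : ℝ)) (𝓝 (0 : ℂ))).mono_left
        nhdsWithin_le_nhds
    · filter_upwards [self_mem_nhdsWithin] with θ hθ
      simpa using hθ
  refine hlim.frequently (Eventually.frequently (Eventually.of_forall fun θ => ?_))
  exact hk.apply_scale_of_re_eq_zero hG hγ hl (by simp)

end StarShaped

/-! ### Weighted orbits and their derivatives -/

section Orbit

variable {n m : ℕ} {γ : Fin n → ℝ} {G : Set ((Fin n → ℂ) × (Fin m → ℂ))}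

/-- The function `φ` along the flow line of `q`, with the weight `e^{Γ s}`, `Γ = ∑ γ_j`, that
compensates the Jacobian of the flow. Its derivative at `s = 0` is
`∑ γ_j (I + z_j ∂/∂z_j) φ` at `q`. -/
noncomputable def orbit (γ : Fin n → ℝ) (φ : (Fin n → ℂ) × (Fin m → ℂ) → ℂ)
    (q : (Fin n → ℂ) × (Fin m → ℂ)) (s : ℂ) : ℂ :=
  Complex.exp ((∑ j, γ j : ℝ) * s) * φ (scale γ s q)

theorem differentiableAt_orbit (hGo : IsOpen G) {φ : (Fin n → ℂ) × (Fin m → ℂ) → ℂ}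
    (hφ : DifferentiableOn ℂ φ G) {q : (Fin n → ℂ) × (Fin m → ℂ)} {s : ℂ}
    (hs : scale γ s q ∈ G) : DifferentiableAt ℂ (orbit γ φ q) s := by
  refine DifferentiableAt.mul (by fun_prop) ?_
  exact (hφ.differentiableAt (hGo.mem_nhds hs)).comp s (differentiable_scale_left γ q s)

theorem orbit_scale (φ : (Fin n → ℂ) × (Fin m → ℂ) → ℂ) (q : (Fin n → ℂ) × (Fin m → ℂ))
    (s t : ℂ) : orbit γ φ (scale γ t q) s =
      Complex.exp (-((∑ j, γ j : ℝ) * t)) * orbit γ φ q (s + t) := by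
  rw [orbit, orbit, scale_scale, mul_add, Complex.exp_add, Complex.exp_neg]
  have := Complex.exp_ne_zero ((∑ j, γ j : ℝ) * t)
  field_simp

theorem deriv_orbit_scale (φ : (Fin n → ℂ) × (Fin m → ℂ) → ℂ) (q : (Fin n → ℂ) × (Fin m → ℂ))
    (s t : ℂ) : deriv (orbit γ φ (scale γ t q)) s =
      Complex.exp (-((∑ j, γ j : ℝ) * t)) * deriv (orbit γ φ q) (s + t) := by
  have : orbit γ φ (scale γ t q) = fun s =>
      Complex.exp (-((∑ j, γ j : ℝ) * t)) * orbit γ φ q (s + t) :=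
    funext fun s => orbit_scale φ q s t
  rw [this, deriv_const_mul_field, deriv_comp_add_const]

theorem orbit_comp_scale (φ : (Fin n → ℂ) × (Fin m → ℂ) → ℂ) (q : (Fin n → ℂ) × (Fin m → ℂ))
    (s t : ℂ) : orbit γ (fun p => φ (scale γ t p)) q s =
      Complex.exp (-((∑ j, γ j : ℝ) * t)) * orbit γ φ q (s + t) := by
  rw [← orbit_scale, orbit, orbit, scale_scale, scale_scale, add_comm]

theorem deriv_orbit_comp_scale (φ : (Fin n → ℂ) × (Fin m → ℂ) → ℂ)
    (q : (Fin n → ℂ) × (Fin m → ℂ)) (s t : ℂ) :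
    deriv (orbit γ (fun p => φ (scale γ t p)) q) s =
      Complex.exp (-((∑ j, γ j : ℝ) * t)) * deriv (orbit γ φ q) (s + t) := by
  have : orbit γ (fun p => φ (scale γ t p)) q = fun s =>
      Complex.exp (-((∑ j, γ j : ℝ) * t)) * orbit γ φ q (s + t) :=
    funext fun s => orbit_comp_scale φ q s t
  rw [this, deriv_const_mul_field, deriv_comp_add_const]

/-- The flow line of `q` over a half plane `Re s ≤ r` with small `r > 0` stays in a compact subset
of `G`, namely in a polydisc. -/
theorem IsPolydiscStable.exists_isCompact_scale_mem (hGo : IsOpen G) (hG : IsPolydiscStable G)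
    (hγ : ∀ j, 0 < γ j) {q : (Fin n → ℂ) × (Fin m → ℂ)} (hq : q ∈ G) :
    ∃ r > 0, ∃ K ⊆ G, IsCompact K ∧ ∀ s : ℂ, s.re ≤ r → scale γ s q ∈ K := by
  obtain ⟨δ, hδ, h⟩ := hG.exists_scale_mem hGo hγ hq
  set r := δ / 2 with hr
  have hmem : scale γ (r : ℂ) q ∈ G := h _ (by rw [Complex.ofReal_re]; linarith)
  refine ⟨r, by positivity, (fun c : Fin n → ℂ =>
    ((fun j => c j * (scale γ (r : ℂ) q).1 j), (scale γ (r : ℂ) q).2)) '' closedBall 0 1,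
    ?_, (isCompact_closedBall _ _).image (by fun_prop), fun s hs => ?_⟩
  · rintro _ ⟨c, hc, rfl⟩
    refine hG _ _ hmem c fun j => ?_
    rw [mem_closedBall_zero_iff] at hc
    exact (norm_le_pi_norm c j).trans hc
  · refine ⟨fun j => Complex.exp (γ j * (s - r)), ?_, ?_⟩
    · rw [mem_closedBall_zero_iff, pi_norm_le_iff_of_nonneg zero_le_one]
      intro j
      rw [Complex.norm_exp, Real.exp_le_one_iff]
      simpa using mul_nonpos_of_nonneg_of_nonpos (hγ j).le (sub_nonpos.2 hs)
    · have := scale_scale γ (s - r) r q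
      rw [sub_add_cancel] at this
      rw [← this]
      rfl

/-- The functionals `φ ↦ ∂_s (e^{Γ s} φ(σ_s q))` are bounded, with exponential decay as
`Re s → -∞`. -/
theorem exists_norm_deriv_orbit_le (hGo : IsOpen G) (hG : IsPolydiscStable G)
    (hγ : ∀ j, 0 < γ j) {q : (Fin n → ℂ) × (Fin m → ℂ)} (hq : q ∈ G) :
    ∃ C, 0 ≤ C ∧ ∀ s : ℂ, s.re ≤ 0 → ∀ φ ∈ bergmanSpace G,
      ‖deriv (orbit γ φ q) s‖ ≤ C * Real.exp ((∑ j, γ j) * s.re) * bergmanNorm G φ := by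
  obtain ⟨r, hr, K, hKG, hK, hscale⟩ := hG.exists_isCompact_scale_mem hGo hγ hq
  obtain ⟨C, hC0, hC⟩ := exists_norm_le_bergmanNorm hGo hK hKG
  have hΓ : 0 ≤ ∑ j, γ j := Finset.sum_nonneg fun j _ => (hγ j).le
  refine ⟨Real.exp ((∑ j, γ j) * r) * C / r, by positivity, fun s hs φ hφ => ?_⟩
  have hre : ∀ t ∈ closedBall s r, t.re ≤ s.re + r := fun t ht => by
    have h1 := (Complex.abs_re_le_norm (t - s)).trans (by simpa [dist_eq_norm] using ht)
    have h2 := le_abs_self (t - s).re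
    rw [Complex.sub_re] at h2 h1
    linarith
  have h := Complex.norm_deriv_le_of_forall_mem_sphere_norm_le (f := orbit γ φ q) (c := s) hr
    (C := Real.exp ((∑ j, γ j) * (s.re + r)) * (C * bergmanNorm G φ)) ?_ ?_
  · refine h.trans_eq ?_
    rw [mul_add, Real.exp_add]
    ring
  · refine DifferentiableOn.diffContOnCl fun t ht => ?_
    rw [closure_ball _ hr.ne'] at ht
    exact (differentiableAt_orbit hGo hφ.1
      (hKG (hscale t ((hre t ht).trans (by linarith))))).differentiableWithinAt
  · intro t ht
    have ht' := hre t (sphere_subset_closedBall ht)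
    rw [orbit, norm_mul, Complex.norm_exp]
    gcongr
    · simpa using mul_le_mul_of_nonneg_left ht' hΓ
    · exact hC _ (hscale t (ht'.trans (by linarith))) φ hφ

/-- The Riesz representer of `φ ↦ ∂_τ (e^{Γ τ} φ(σ_τ q))` at `τ = s̄` is
`u ↦ ∂_s (e^{Γ s} K_G(σ_s u; q̄))`. The symmetry of the kernel under the flow moves the
differentiation from one variable to the other. -/
theorem exists_riesz_deriv_orbit (hGo : IsOpen G) (hG : IsPolydiscStable G)
    (hγ : ∀ j, 0 < γ j) {q : (Fin n → ℂ) × (Fin m → ℂ)} (hq : q ∈ G)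
    {k : (Fin n → ℂ) × (Fin m → ℂ) → ℂ} (hk : IsRepresenter G q k) :
    ∃ C, 0 ≤ C ∧ ∀ s : ℂ, s.re < 0 → ∃ b ∈ bergmanSpace G,
      bergmanNorm G b ≤ C * Real.exp ((∑ j, γ j) * s.re) ∧
      (∀ φ ∈ bergmanSpace G, deriv (orbit γ φ q) (conj s) = ∫ u in G, conj (b u) * φ u) ∧
      ∀ u ∈ G, b u = deriv (orbit γ k u) s := by
  obtain ⟨C, hC0, hC⟩ := exists_norm_deriv_orbit_le hGo hG hγ hq
  refine ⟨C, hC0, fun s hs => ?_⟩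
  have hcs : (conj s).re ≤ 0 := by rw [Complex.conj_re]; exact hs.le
  have hmem : scale γ (conj s) q ∈ G := hG.scale_mem hγ hcs hq
  obtain ⟨b, hb, hbn, hbr⟩ := exists_riesz_bergmanSpace hGo
    (L := fun φ => deriv (orbit γ φ q) (conj s)) (C := C * Real.exp ((∑ j, γ j) * s.re))
    (fun f hf g hg => by
      have : orbit γ (f + g) q = fun t => orbit γ f q t + orbit γ g q t :=
        funext fun t => by simp [orbit, mul_add]
      rw [this, deriv_fun_add (differentiableAt_orbit hGo hf.1 hmem)
        (differentiableAt_orbit hGo hg.1 hmem)])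
    (fun c f hf => by
      have : orbit γ (c • f) q = fun t => c * orbit γ f q t :=
        funext fun t => by simp only [orbit, Pi.smul_apply, smul_eq_mul]; ring
      rw [this, deriv_const_mul_field])
    (by positivity) (fun f hf => by simpa using hC _ hcs f hf)
  refine ⟨b, hb, hbn, hbr, fun u hu => ?_⟩
  obtain ⟨l, hl⟩ := exists_isRepresenter hGo hu
  rw [hl.2 b hb, integral_conj_mul_comm, ← hbr l hl.1]
  have hev : orbit γ l q =ᶠ[𝓝 (conj s)] (conj ∘ orbit γ k u ∘ conj) := by
    have : {t : ℂ | t.re < 0} ∈ 𝓝 (conj s) :=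
      (isOpen_lt Complex.continuous_re continuous_const).mem_nhds (by simpa using hs)
    filter_upwards [this] with t ht
    simp only [Function.comp, orbit, map_mul, ← Complex.exp_conj, Complex.conj_ofReal,
      Complex.conj_conj]
    rw [hk.apply_scale hGo hG hγ hu hq hl (s := conj t)
      (by rw [Complex.conj_re]; exact (show t.re < 0 from ht).le), Complex.conj_conj,
      Complex.conj_conj]
  rw [hev.deriv_eq, deriv_conj_conj]
  simp

end Orbit

/-! ### The fibred domain -/

section Fibration

variable {n m : ℕ} {γ : Fin n → ℝ} {η : ℂ} {G : Set ((Fin n → ℂ) × (Fin m → ℂ))}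

/-- The domain fibred over the `w`-plane whose fibre over `η` is `G`: the fibre over `w` is the
preimage of `G` under the flow at the real time `(|w|² - |η|²) / 2`. -/
def fibredDomain (γ : Fin n → ℝ) (η : ℂ) (G : Set ((Fin n → ℂ) × (Fin m → ℂ))) :
    Set (((Fin n → ℂ) × (Fin m → ℂ)) × ℂ) :=
  {x | scale γ ((‖x.2‖ ^ 2 - ‖η‖ ^ 2) / 2 : ℝ) x.1 ∈ G}

theorem isOpen_fibredDomain (hGo : IsOpen G) : IsOpen (fibredDomain γ η G) := by
  have h : Continuous fun x : ((Fin n → ℂ) × (Fin m → ℂ)) × ℂ =>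
      ((((‖x.2‖ ^ 2 - ‖η‖ ^ 2) / 2 : ℝ) : ℂ), x.1) := by fun_prop
  exact hGo.preimage ((differentiable_scale γ).continuous.comp h)

theorem re_mul_conj_sub_le (w η : ℂ) :
    (w * conj η - (‖η‖ : ℂ) ^ 2).re ≤ (‖w‖ ^ 2 - ‖η‖ ^ 2) / 2 := by
  have h : 0 ≤ Complex.normSq (w - η) := Complex.normSq_nonneg _
  rw [Complex.normSq_sub, Complex.normSq_eq_norm_sq, Complex.normSq_eq_norm_sq] at h
  rw [← Complex.ofReal_pow, Complex.sub_re, Complex.ofReal_re]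
  linarith

theorem IsPolydiscStable.scale_mem_of_mem_fibredDomain (hG : IsPolydiscStable G)
    (hγ : ∀ j, 0 < γ j) {x : ((Fin n → ℂ) × (Fin m → ℂ)) × ℂ} (hx : x ∈ fibredDomain γ η G) :
    scale γ (x.2 * conj η - (‖η‖ : ℂ) ^ 2) x.1 ∈ G :=
  hG.scale_mem_of_re_le hγ (by rw [Complex.ofReal_re]; exact re_mul_conj_sub_le x.2 η) hx

/-- The candidate for the kernel of the fibred domain, as a function of its first variable; `k` is
the kernel function of the fibre `G` over `η` at the second variable. -/
noncomputable def totalKernel (γ : Fin n → ℝ) (η : ℂ) (k : (Fin n → ℂ) × (Fin m → ℂ) → ℂ)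
    (x : ((Fin n → ℂ) × (Fin m → ℂ)) × ℂ) : ℂ :=
  1 / (Real.pi : ℂ) * deriv (orbit γ k x.1) (x.2 * conj η - (‖η‖ : ℂ) ^ 2)

/-- The weighted orbit is jointly holomorphic, and so is its derivative in `s`. -/
theorem differentiableOn_deriv_orbit (hGo : IsOpen G) {k : (Fin n → ℂ) × (Fin m → ℂ) → ℂ}
    (hk : DifferentiableOn ℂ k G) :
    DifferentiableOn ℂ (fun x : ℂ × ((Fin n → ℂ) × (Fin m → ℂ)) => deriv (orbit γ k x.2) x.1)
      {x | scale γ x.1 x.2 ∈ G} := by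
  have hU : IsOpen {x : ℂ × ((Fin n → ℂ) × (Fin m → ℂ)) | scale γ x.1 x.2 ∈ G} :=
    hGo.preimage (differentiable_scale γ).continuous
  refine differentiableOn_deriv_fst (f := fun x : ℂ × ((Fin n → ℂ) × (Fin m → ℂ)) =>
    orbit γ k x.2 x.1) hU ?_
  refine DifferentiableOn.mul (Differentiable.differentiableOn (by fun_prop)) ?_
  exact hk.comp (differentiable_scale γ).differentiableOn fun x hx => hx

theorem differentiableOn_totalKernel (hGo : IsOpen G) (hG : IsPolydiscStable G)
    (hγ : ∀ j, 0 < γ j) {k : (Fin n → ℂ) × (Fin m → ℂ) → ℂ} (hk : DifferentiableOn ℂ k G) :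
    DifferentiableOn ℂ (totalKernel γ η k) (fibredDomain γ η G) := by
  refine DifferentiableOn.const_mul ?_ _
  have h : Differentiable ℂ fun x : ((Fin n → ℂ) × (Fin m → ℂ)) × ℂ =>
      (x.2 * conj η - (‖η‖ : ℂ) ^ 2, x.1) := by fun_prop
  exact (differentiableOn_deriv_orbit (γ := γ) hGo hk).comp h.differentiableOn
    fun x hx => hG.scale_mem_of_mem_fibredDomain hγ hx

/-- On the fibre over `w`, transported to `G`, the candidate is a derivative at the point
`w η̄ - (|w|² + |η|²) / 2`, which lies in the left half plane. -/
theorem totalKernel_scale (k : (Fin n → ℂ) × (Fin m → ℂ) → ℂ) (u : (Fin n → ℂ) × (Fin m → ℂ))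
    (w : ℂ) : totalKernel γ η k (scale γ (-((‖w‖ ^ 2 - ‖η‖ ^ 2) / 2 : ℝ)) u, w) =
      1 / (Real.pi : ℂ) * ((Real.exp ((∑ j, γ j) * ((‖w‖ ^ 2 - ‖η‖ ^ 2) / 2)) : ℂ) *
        deriv (orbit γ k u) (w * conj η - ((‖w‖ ^ 2 + ‖η‖ ^ 2) / 2 : ℝ))) := by
  rw [totalKernel, deriv_orbit_scale]
  congr 3
  · push_cast; congr 1; ring
  · push_cast; ring

theorem re_mul_conj_sub_half (w η : ℂ) :
    (w * conj η - ((‖w‖ ^ 2 + ‖η‖ ^ 2) / 2 : ℝ)).re = -(‖w - η‖ ^ 2 / 2) := by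
  rw [Complex.sub_re, Complex.ofReal_re, ← Complex.normSq_eq_norm_sq (w - η), Complex.normSq_sub,
    Complex.normSq_eq_norm_sq, Complex.normSq_eq_norm_sq]
  ring

theorem setLIntegral_fibredDomain (hGo : IsOpen G)
    {g : ((Fin n → ℂ) × (Fin m → ℂ)) × ℂ → ENNReal}
    (hg : AEMeasurable g (volume.restrict (fibredDomain γ η G))) :
    ∫⁻ x in fibredDomain γ η G, g x = ∫⁻ w : ℂ, ∫⁻ p in
      scale γ ((‖w‖ ^ 2 - ‖η‖ ^ 2) / 2 : ℝ) ⁻¹' G, g (p, w) := by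
  have hV : MeasurableSet (fibredDomain γ η G) := (isOpen_fibredDomain hGo).measurableSet
  rw [← lintegral_indicator hV]
  refine (lintegral_prod_symm _ ((aemeasurable_indicator_iff hV).2 hg)).trans ?_
  refine lintegral_congr fun w => ?_
  rw [← lintegral_indicator (isOpen_preimage_scale hGo _).measurableSet]
  rfl

theorem setIntegral_fibredDomain (hGo : IsOpen G)
    {g : ((Fin n → ℂ) × (Fin m → ℂ)) × ℂ → ℂ}
    (hg : IntegrableOn g (fibredDomain γ η G)) :
    Integrable (fun w : ℂ => ∫ p in scale γ ((‖w‖ ^ 2 - ‖η‖ ^ 2) / 2 : ℝ) ⁻¹' G, g (p, w)) ∧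
    ∫ x in fibredDomain γ η G, g x = ∫ w : ℂ, ∫ p in
      scale γ ((‖w‖ ^ 2 - ‖η‖ ^ 2) / 2 : ℝ) ⁻¹' G, g (p, w) := by
  have hV : MeasurableSet (fibredDomain γ η G) := (isOpen_fibredDomain hGo).measurableSet
  have h1 : Integrable ((fibredDomain γ η G).indicator g) := (integrable_indicator_iff hV).2 hg
  have h2 : ∀ w : ℂ, ∫ p, (fibredDomain γ η G).indicator g (p, w) =
      ∫ p in scale γ ((‖w‖ ^ 2 - ‖η‖ ^ 2) / 2 : ℝ) ⁻¹' G, g (p, w) := fun w => by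
    rw [← integral_indicator (isOpen_preimage_scale hGo _).measurableSet]
    rfl
  simp only [← h2]
  refine ⟨Integrable.integral_prod_right h1, ?_⟩
  rw [← integral_indicator hV]
  exact integral_prod_symm _ h1

/-- Almost every fibre restriction of an element of the Bergman space of the fibred domain belongs
to the Bergman space of the fibre. -/
theorem ae_fibre_mem_bergmanSpace (hGo : IsOpen G) {f : ((Fin n → ℂ) × (Fin m → ℂ)) × ℂ → ℂ}
    (hf : f ∈ bergmanSpace (fibredDomain γ η G)) :
    ∀ᵐ w : ℂ, (fun p => f (p, w)) ∈
      bergmanSpace (scale γ ((‖w‖ ^ 2 - ‖η‖ ^ 2) / 2 : ℝ) ⁻¹' G) := by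
  have hfin : ∫⁻ x in fibredDomain γ η G, ‖f x‖ₑ ^ (2 : ℝ) < ⊤ := by
    have := (eLpNorm_lt_top_iff_lintegral_rpow_enorm_lt_top (by norm_num) (by norm_num)).1 hf.2.2
    simpa using this
  have hmeas : AEMeasurable (fun x => ‖f x‖ₑ ^ (2 : ℝ))
      (volume.restrict (fibredDomain γ η G)) := hf.2.1.enorm.pow_const _
  have hind : AEMeasurable ((fibredDomain γ η G).indicator fun x => ‖f x‖ₑ ^ (2 : ℝ))
      ((volume : Measure ((Fin n → ℂ) × (Fin m → ℂ))).prod (volume : Measure ℂ)) :=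
    (aemeasurable_indicator_iff (isOpen_fibredDomain hGo).measurableSet).2 hmeas
  rw [setLIntegral_fibredDomain hGo hmeas] at hfin
  have hmeas2 : AEMeasurable (fun w : ℂ => ∫⁻ p in
      scale γ ((‖w‖ ^ 2 - ‖η‖ ^ 2) / 2 : ℝ) ⁻¹' G, ‖f (p, w)‖ₑ ^ (2 : ℝ)) := by
    refine (hind.prod_swap.lintegral_prod_right').congr (ae_of_all _ fun w => ?_)
    simp only
    rw [← lintegral_indicator (isOpen_preimage_scale hGo _).measurableSet]
    rfl
  filter_upwards [ae_lt_top' hmeas2 hfin.ne] with w hw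
  have hd : DifferentiableOn ℂ (fun p => f (p, w))
      (scale γ ((‖w‖ ^ 2 - ‖η‖ ^ 2) / 2 : ℝ) ⁻¹' G) :=
    hf.1.comp (f := fun p => (p, w)) (Differentiable.differentiableOn (by fun_prop))
      fun p hp => hp
  refine ⟨hd, hd.continuousOn.aestronglyMeasurable (isOpen_preimage_scale hGo _).measurableSet, ?_⟩
  rw [eLpNorm_lt_top_iff_lintegral_rpow_enorm_lt_top (by norm_num) (by norm_num)]
  simpa using hw

theorem integrable_exp_neg_norm_sub_sq {c : ℝ} (hc : 0 < c) (η : ℂ) :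
    Integrable (fun w : ℂ => Real.exp (-(c * ‖w - η‖ ^ 2))) := by
  have h := (GaussianFourier.integrable_cexp_neg_mul_sq_norm_add (V := ℂ) (b := (c : ℂ))
    (by simpa using hc) 0 0).norm
  refine (h.comp_sub_right η).congr (ae_of_all _ fun w => ?_)
  simp only [Complex.norm_exp]
  congr 1
  rw [← Complex.ofReal_pow, ← Complex.ofReal_neg, zero_mul, add_zero, ← Complex.ofReal_mul,
    Complex.ofReal_re, neg_mul]

theorem totalKernel_mem_bergmanSpace (hGo : IsOpen G) (hG : IsPolydiscStable G)
    (hγ : ∀ j, 0 < γ j) (hΓ : 0 < ∑ j, γ j) {q : (Fin n → ℂ) × (Fin m → ℂ)} (hq : q ∈ G)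
    {k : (Fin n → ℂ) × (Fin m → ℂ) → ℂ} (hk : IsRepresenter G q k) :
    totalKernel γ η k ∈ bergmanSpace (fibredDomain γ η G) := by
  have hd := differentiableOn_totalKernel (η := η) hGo hG hγ hk.1.1
  have hm : AEStronglyMeasurable (totalKernel γ η k) (volume.restrict (fibredDomain γ η G)) :=
    hd.continuousOn.aestronglyMeasurable (isOpen_fibredDomain hGo).measurableSet
  refine ⟨hd, hm, ?_⟩
  rw [eLpNorm_lt_top_iff_lintegral_rpow_enorm_lt_top (by norm_num) (by norm_num)]
  simp only [ENNReal.toReal_ofNat]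
  rw [setLIntegral_fibredDomain hGo (hm.enorm.pow_const _)]
  obtain ⟨C, hC0, hC⟩ := exists_riesz_deriv_orbit hGo hG hγ hq hk
  set Γ := ∑ j, γ j with hΓdef
  have hint : Integrable (fun w : ℂ => (1 / Real.pi * C) ^ 2 * Real.exp (-(Γ * ‖w - η‖ ^ 2))) :=
    (integrable_exp_neg_norm_sub_sq hΓ η).const_mul _
  refine lt_of_le_of_lt (lintegral_mono_ae ?_) hint.lintegral_lt_top
  have hne : ∀ᵐ w : ℂ, w ≠ η := by simp [ae_iff]
  filter_upwards [hne] with w hw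
  set a : ℝ := (‖w‖ ^ 2 - ‖η‖ ^ 2) / 2 with ha
  set s : ℂ := w * conj η - ((‖w‖ ^ 2 + ‖η‖ ^ 2) / 2 : ℝ) with hs
  have hsre : s.re = -(‖w - η‖ ^ 2 / 2) := re_mul_conj_sub_half w η
  have hsneg : s.re < 0 := by
    have : 0 < ‖w - η‖ := norm_pos_iff.2 (sub_ne_zero.2 hw)
    rw [hsre]
    have : 0 < ‖w - η‖ ^ 2 / 2 := by positivity
    linarith
  obtain ⟨b, hb, hbn, -, hbu⟩ := hC s hsneg
  have h1 : ∀ p, ‖totalKernel γ η k (p, w)‖ₑ ^ (2 : ℝ) =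
      (fun u => ‖totalKernel γ η k (scale γ (-(a : ℂ)) u, w)‖ₑ ^ (2 : ℝ)) (scale γ (a : ℂ) p) :=
    fun p => by simp only [scale_neg_scale]
  rw [lintegral_congr h1]
  rw [setLIntegral_comp_scale γ (a : ℂ) G
    (fun u => ‖totalKernel γ η k (scale γ (-(a : ℂ)) u, w)‖ₑ ^ (2 : ℝ))]
  have h2 : ∫⁻ u in G, ‖totalKernel γ η k (scale γ (-(a : ℂ)) u, w)‖ₑ ^ (2 : ℝ) =
      ENNReal.ofReal ((1 / Real.pi * Real.exp (Γ * a)) ^ 2) * ∫⁻ u in G, ‖b u‖ₑ ^ (2 : ℝ) := by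
    rw [← lintegral_const_mul' _ _ ENNReal.ofReal_ne_top]
    refine setLIntegral_congr_fun hGo.measurableSet fun u hu => ?_
    rw [totalKernel_scale, ← hbu u hu, ← mul_assoc, enorm_mul,
      ENNReal.mul_rpow_of_nonneg _ _ (by norm_num)]
    congr 1
    rw [← ofReal_norm, ENNReal.rpow_two, ← ENNReal.ofReal_pow (norm_nonneg _)]
    congr 2
    rw [norm_mul, norm_div, norm_one, Complex.norm_real, Complex.norm_real,
      Real.norm_of_nonneg Real.pi_pos.le, Real.norm_of_nonneg (Real.exp_pos _).le]
  have h3 : ∫⁻ u in G, ‖b u‖ₑ ^ (2 : ℝ) = ENNReal.ofReal (bergmanNorm G b ^ 2) := by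
    rw [ENNReal.ofReal_pow (bergmanNorm_nonneg _ _), bergmanNorm, ENNReal.ofReal_toReal hb.2.2.ne,
      eLpNorm_eq_lintegral_rpow_enorm_toReal (by norm_num) (by norm_num), ENNReal.toReal_ofNat,
      ← ENNReal.rpow_two, ← ENNReal.rpow_mul]
    norm_num
  rw [h2, h3, ← ENNReal.ofReal_mul (by positivity), ← ENNReal.ofReal_mul (by positivity)]
  refine ENNReal.ofReal_le_ofReal ?_
  have h4 : bergmanNorm G b ^ 2 ≤ (C * Real.exp (Γ * s.re)) ^ 2 :=
    pow_le_pow_left₀ (bergmanNorm_nonneg _ _) hbn 2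
  calc _ ≤ Real.exp (-2 * Γ * (a : ℂ).re) *
        ((1 / Real.pi * Real.exp (Γ * a)) ^ 2 * (C * Real.exp (Γ * s.re)) ^ 2) := by gcongr
    _ = (1 / Real.pi * C) ^ 2 *
        Real.exp (-2 * Γ * a + (2 * (Γ * a) + 2 * (Γ * s.re))) := by
        rw [Real.exp_add, Real.exp_add, Complex.ofReal_re, two_mul (Γ * a), two_mul (Γ * s.re),
          Real.exp_add, Real.exp_add]
        ring
    _ = _ := by rw [hsre]; congr 2; ring

/-- The inner integral of the reproducing formula, over the fibre over `w ≠ η`. -/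
theorem setIntegral_fibre_totalKernel (hGo : IsOpen G) (hG : IsPolydiscStable G)
    (hγ : ∀ j, 0 < γ j) {q : (Fin n → ℂ) × (Fin m → ℂ)} (hq : q ∈ G)
    {k : (Fin n → ℂ) × (Fin m → ℂ) → ℂ} (hk : IsRepresenter G q k) {w : ℂ} (hw : w ≠ η)
    {φ : (Fin n → ℂ) × (Fin m → ℂ) → ℂ}
    (hφ : φ ∈ bergmanSpace (scale γ ((‖w‖ ^ 2 - ‖η‖ ^ 2) / 2 : ℝ) ⁻¹' G)) :
    ∫ p in scale γ ((‖w‖ ^ 2 - ‖η‖ ^ 2) / 2 : ℝ) ⁻¹' G, conj (totalKernel γ η k (p, w)) * φ p =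
      1 / (Real.pi : ℂ) * deriv (orbit γ φ q) (conj w * η - (‖w‖ : ℂ) ^ 2) := by
  obtain ⟨C, hC0, hC⟩ := exists_riesz_deriv_orbit hGo hG hγ hq hk
  set Γ := ∑ j, γ j with hΓdef
  have htk := fun u => totalKernel_scale (γ := γ) (η := η) k u w
  set a : ℝ := (‖w‖ ^ 2 - ‖η‖ ^ 2) / 2 with ha
  set s : ℂ := w * conj η - ((‖w‖ ^ 2 + ‖η‖ ^ 2) / 2 : ℝ) with hs
  have hsre : s.re = -(‖w - η‖ ^ 2 / 2) := re_mul_conj_sub_half w η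
  have hsneg : s.re < 0 := by
    have : 0 < ‖w - η‖ := norm_pos_iff.2 (sub_ne_zero.2 hw)
    rw [hsre]
    have : 0 < ‖w - η‖ ^ 2 / 2 := by positivity
    linarith
  obtain ⟨b, hb, -, hbr, hbu⟩ := hC s hsneg
  have hφ' : (fun p => φ (scale γ (-(a : ℂ)) p)) ∈ bergmanSpace G := by
    have h := comp_scale_mem_bergmanSpace γ (-(a : ℂ)) hφ
    have hpre : scale γ (-(a : ℂ)) ⁻¹' (scale γ (a : ℂ) ⁻¹' G) = G := by
      ext p; simp only [mem_preimage, scale_scale_neg]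
    rwa [hpre] at h
  have h1 : ∀ p, conj (totalKernel γ η k (p, w)) * φ p =
      (fun u => conj (totalKernel γ η k (scale γ (-(a : ℂ)) u, w)) * φ (scale γ (-(a : ℂ)) u))
        (scale γ (a : ℂ) p) :=
    fun p => by simp only [scale_neg_scale]
  rw [integral_congr_ae (ae_of_all _ h1)]
  rw [setIntegral_comp_scale γ (a : ℂ) G
    (fun u => conj (totalKernel γ η k (scale γ (-(a : ℂ)) u, w)) * φ (scale γ (-(a : ℂ)) u))]
  have h2 : ∫ u in G, conj (totalKernel γ η k (scale γ (-(a : ℂ)) u, w)) *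
      φ (scale γ (-(a : ℂ)) u) = 1 / (Real.pi : ℂ) * (Real.exp (Γ * a) : ℂ) *
        ∫ u in G, conj (b u) * φ (scale γ (-(a : ℂ)) u) := by
    rw [← integral_const_mul]
    refine setIntegral_congr_fun hGo.measurableSet fun u hu => ?_
    rw [htk, ← hbu u hu]
    simp only [map_mul, map_div₀, map_one, Complex.conj_ofReal]
    ring
  rw [h2, ← hbr _ hφ', deriv_orbit_comp_scale]
  have h3 : conj s + -(a : ℂ) = conj w * η - (‖w‖ : ℂ) ^ 2 := by
    rw [hs, ha, map_sub, map_mul, Complex.conj_conj, Complex.conj_ofReal]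
    push_cast; ring
  rw [h3, ← hΓdef]
  have h4 : (Real.exp (-2 * Γ * (a : ℂ).re) : ℂ) * ((Real.exp (Γ * a) : ℂ) *
      Complex.exp (-((Γ : ℂ) * -(a : ℂ)))) = 1 := by
    rw [Complex.ofReal_re]
    push_cast
    rw [← Complex.exp_add, ← Complex.exp_add, Complex.exp_eq_one_iff]
    exact ⟨0, by push_cast; ring⟩
  linear_combination (1 / (Real.pi : ℂ) *
    deriv (orbit γ φ q) (conj w * η - (‖w‖ : ℂ) ^ 2)) * h4

end Fibration

/-! ### Integration by circular means -/

section PlaneIntegral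

theorem setIntegral_Ioo_circle (J : ℂ → ℂ) (r : ℝ) :
    ∫ θ in Ioo (-Real.pi) Real.pi, J (circleMap 0 r θ) =
      (2 * Real.pi : ℝ) • Real.circleAverage J 0 r := by
  rw [Real.circleAverage_def, smul_inv_smul₀ (by positivity), ← integral_Ioc_eq_integral_Ioo,
    ← intervalIntegral.integral_of_le (by linarith [Real.pi_pos])]
  have hper : Function.Periodic (fun θ => J (circleMap 0 r θ)) (2 * Real.pi) :=
    (periodic_circleMap 0 r).comp J
  have h := hper.intervalIntegral_add_eq (-Real.pi) 0
  rw [zero_add] at h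
  rw [← h]
  congr 1
  ring

/-- Integration over the plane by circular means, when `r` times the circular mean has an
antiderivative vanishing at infinity. -/
theorem integral_eq_of_hasDerivAt_circleAverage {J : ℂ → ℂ} (hJc : Continuous J)
    (hJ : Integrable J) {A : ℝ → ℂ} (hA0 : ContinuousWithinAt A (Ici 0) 0)
    (hA : ∀ r : ℝ, 0 < r → HasDerivAt A (r • Real.circleAverage J 0 r) r)
    (hlim : Tendsto A atTop (𝓝 0)) : ∫ v, J v = -((2 * Real.pi : ℝ) • A 0) := by
  have hpolar : ∀ p : ℝ × ℝ, Complex.polarCoord.symm p = circleMap 0 p.1 p.2 := fun p => by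
    rw [Complex.polarCoord_symm_apply, circleMap, zero_add, Complex.exp_mul_I]
    push_cast; rfl
  have htarget : polarCoord.target = Ioi (0 : ℝ) ×ˢ Ioo (-Real.pi) Real.pi := rfl
  have hcont : Continuous fun p : ℝ × ℝ => p.1 • J (circleMap 0 p.1 p.2) := by
    refine continuous_fst.smul (hJc.comp ?_)
    unfold circleMap
    fun_prop
  have hint : IntegrableOn (fun p : ℝ × ℝ => p.1 • J (circleMap 0 p.1 p.2))
      (Ioi (0 : ℝ) ×ˢ Ioo (-Real.pi) Real.pi) := by
    refine ⟨hcont.aestronglyMeasurable, ?_⟩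
    rw [hasFiniteIntegral_iff_enorm]
    have h1 := hJ.2
    rw [hasFiniteIntegral_iff_enorm, ← Complex.lintegral_comp_polarCoord_symm, htarget] at h1
    refine lt_of_le_of_lt (le_of_eq ?_) h1
    refine setLIntegral_congr_fun (measurableSet_Ioi.prod measurableSet_Ioo) fun p hp => ?_
    have hp1 : 0 < p.1 := hp.1
    simp only [hpolar, smul_eq_mul]
    rw [enorm_smul, Real.enorm_of_nonneg hp1.le]
  have hinner : ∀ r : ℝ, ∫ θ in Ioo (-Real.pi) Real.pi, r • J (circleMap 0 r θ) =
      (2 * Real.pi : ℝ) • (r • Real.circleAverage J 0 r) := fun r => by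
    rw [integral_smul, setIntegral_Ioo_circle, smul_comm]
  have hint2 : IntegrableOn (fun r : ℝ => r • Real.circleAverage J 0 r) (Ioi 0) := by
    have h2 := hint
    rw [IntegrableOn, Measure.volume_eq_prod, ← Measure.prod_restrict] at h2
    have h3 := (h2.integral_prod_left).const_mul (2 * Real.pi : ℂ)⁻¹
    refine h3.congr (ae_of_all _ fun r => ?_)
    simp only [hinner]
    rw [Complex.real_smul]
    have : (Real.pi : ℂ) ≠ 0 := by exact_mod_cast Real.pi_ne_zero
    push_cast
    field_simp
  rw [← Complex.integral_comp_polarCoord_symm, htarget]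
  simp only [hpolar]
  rw [Measure.volume_eq_prod, setIntegral_prod _ (by rwa [← Measure.volume_eq_prod])]
  simp only [hinner]
  rw [integral_smul, integral_Ioi_of_hasDerivAt_of_tendsto hA0 (fun r hr => hA r hr) hint2 hlim,
    zero_sub, smul_neg]

end PlaneIntegral

/-! ### The reproducing property -/

section Reproducing

variable {n m : ℕ} {γ : Fin n → ℝ} {η : ℂ} {G : Set ((Fin n → ℂ) × (Fin m → ℂ))}

theorem tendsto_scale_atBot (hγ : ∀ j, 0 < γ j) (q : (Fin n → ℂ) × (Fin m → ℂ)) :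
    Tendsto (fun t : ℝ => scale γ (t : ℂ) q) atBot (𝓝 (0, q.2)) := by
  refine Tendsto.prodMk_nhds (tendsto_pi_nhds.2 fun j => ?_) tendsto_const_nhds
  rw [Pi.zero_apply, tendsto_zero_iff_norm_tendsto_zero]
  have h : Tendsto (fun t : ℝ => Real.exp (γ j * t) * ‖q.1 j‖) atBot (𝓝 (0 * ‖q.1 j‖)) :=
    (Real.tendsto_exp_atBot.comp (tendsto_id.const_mul_atBot (hγ j))).mul_const _
  rw [zero_mul] at h
  refine h.congr fun t => ?_
  rw [norm_mul, Complex.norm_exp]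
  simp

/-- The weighted orbit of a function on the fibre over `η` vanishes at `-∞`. -/
theorem tendsto_orbit_atBot (hGo : IsOpen G) (hG : IsPolydiscStable G) (hγ : ∀ j, 0 < γ j)
    (hΓ : 0 < ∑ j, γ j) {q : (Fin n → ℂ) × (Fin m → ℂ)} (hq : q ∈ G)
    {φ : (Fin n → ℂ) × (Fin m → ℂ) → ℂ} (hφ : ContinuousOn φ G) :
    Tendsto (fun t : ℝ => orbit γ φ q t) atBot (𝓝 0) := by
  have h0 : ((0 : Fin n → ℂ), q.2) ∈ G := by
    have h := hG q.1 q.2 hq 0 (fun j => by simp)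
    simp only [Pi.zero_apply, zero_mul] at h
    exact h
  have h1 := (hφ.continuousAt (hGo.mem_nhds h0)).tendsto.comp (tendsto_scale_atBot hγ q)
  have h2 : Tendsto (fun t : ℝ => Complex.exp ((∑ j, γ j : ℝ) * (t : ℂ))) atBot (𝓝 0) := by
    rw [tendsto_zero_iff_norm_tendsto_zero]
    refine (Real.tendsto_exp_atBot.comp (tendsto_id.const_mul_atBot hΓ)).congr fun t => ?_
    rw [Complex.norm_exp, ← Complex.ofReal_mul, Complex.ofReal_re]; rfl
  have h3 := h2.mul h1
  rw [zero_mul] at h3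
  exact h3

theorem scale_mem_fibredDomain (hG : IsPolydiscStable G) (hγ : ∀ j, 0 < γ j)
    {q : (Fin n → ℂ) × (Fin m → ℂ)} (hq : q ∈ G) {s w : ℂ}
    (hs : s.re ≤ -((‖w‖ ^ 2 - ‖η‖ ^ 2) / 2)) : (scale γ s q, w) ∈ fibredDomain γ η G := by
  change scale γ _ (scale γ s q) ∈ G
  rw [scale_scale]
  refine hG.scale_mem hγ ?_ hq
  rw [Complex.add_re, Complex.ofReal_re]
  linarith

/-- The outer integral of the reproducing formula. Centred at `η`, the circular mean of the
integrand over `|v| = r` is the value at the centre of a function holomorphic in `v`, with `r`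
frozen in its first argument; it is an exact derivative in `r`. -/
theorem integral_deriv_orbit (hGo : IsOpen G) (hG : IsPolydiscStable G) (hγ : ∀ j, 0 < γ j)
    (hΓ : 0 < ∑ j, γ j) {q : (Fin n → ℂ) × (Fin m → ℂ)} (hq : q ∈ G)
    {f : ((Fin n → ℂ) × (Fin m → ℂ)) × ℂ → ℂ}
    (hf : DifferentiableOn ℂ f (fibredDomain γ η G))
    (hint : Integrable fun w : ℂ =>
      deriv (orbit γ (fun p => f (p, w)) q) (conj w * η - (‖w‖ : ℂ) ^ 2)) :
    ∫ w : ℂ, deriv (orbit γ (fun p => f (p, w)) q) (conj w * η - (‖w‖ : ℂ) ^ 2) =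
      Real.pi * f (q, η) := by
  have hV := isOpen_fibredDomain (γ := γ) (η := η) hGo
  let H : ℂ × ℂ → ℂ := fun x => deriv (orbit γ (fun p => f (p, x.2)) q) x.1
  let U : Set (ℂ × ℂ) := {x | (scale γ x.1 q, x.2) ∈ fibredDomain γ η G}
  have hmap : Differentiable ℂ fun x : ℂ × ℂ => (scale γ x.1 q, x.2) :=
    ((differentiable_scale_left γ q).comp differentiable_fst).prodMk differentiable_snd
  have hU : IsOpen U := hV.preimage hmap.continuous
  have hH : DifferentiableOn ℂ H U := by
    refine differentiableOn_deriv_fst (f := fun x : ℂ × ℂ =>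
      orbit γ (fun p => f (p, x.2)) q x.1) hU ?_
    refine DifferentiableOn.mul (Differentiable.differentiableOn (by fun_prop)) ?_
    exact hf.comp hmap.differentiableOn fun x hx => hx
  -- `(-t - η̄ v, η + v)` lies in the domain as long as `|v|² ≤ 2 t`
  have hmem : ∀ (t : ℝ) (v : ℂ), ‖v‖ ^ 2 ≤ 2 * t → (-(t : ℂ) - conj η * v, η + v) ∈ U := by
    intro t v htv
    refine scale_mem_fibredDomain hG hγ hq ?_
    have h1 : ‖η + v‖ ^ 2 = ‖η‖ ^ 2 + ‖v‖ ^ 2 + 2 * (η * conj v).re := by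
      rw [← Complex.normSq_eq_norm_sq, Complex.normSq_add, Complex.normSq_eq_norm_sq,
        Complex.normSq_eq_norm_sq]
    have h2 : (conj η * v).re = (η * conj v).re := by
      simp [Complex.mul_re]
    rw [h1, Complex.sub_re, Complex.neg_re, Complex.ofReal_re, h2]
    linarith
  let J : ℂ → ℂ := fun v => H (-((‖v‖ ^ 2 : ℝ) : ℂ) - conj η * v, η + v)
  have hJeq : ∀ v : ℂ, deriv (orbit γ (fun p => f (p, v + η)) q)
      (conj (v + η) * η - (‖v + η‖ : ℂ) ^ 2) = J v := by
    intro v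
    simp only [J, H]
    rw [add_comm v η]
    congr 1
    rw [← Complex.conj_mul', Complex.ofReal_pow, ← Complex.conj_mul', map_add]
    ring
  have hJint : Integrable J := by
    refine (hint.comp_add_right η).congr (ae_of_all _ fun v => ?_)
    exact hJeq v
  have hJc : Continuous J := by
    have hc : Continuous fun v : ℂ => (-((‖v‖ ^ 2 : ℝ) : ℂ) - conj η * v, η + v) := by fun_prop
    exact hH.continuousOn.comp_continuous hc fun v => hmem _ v (by nlinarith [norm_nonneg v])
  have havg : ∀ r : ℝ, 0 < r → Real.circleAverage J 0 r = H (-((r ^ 2 : ℝ) : ℂ), η) := by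
    intro r hr
    have h1 : Real.circleAverage J 0 r =
        Real.circleAverage (fun v => H (-((r ^ 2 : ℝ) : ℂ) - conj η * v, η + v)) 0 r := by
      refine Real.circleAverage_congr_sphere fun v hv => ?_
      rw [mem_sphere_zero_iff_norm, abs_of_pos hr] at hv
      simp only [J, hv]
    rw [h1, DiffContOnCl.circleAverage]
    · simp
    · refine DifferentiableOn.diffContOnCl fun v hv => ?_
      rw [abs_of_pos hr, closure_ball _ hr.ne', mem_closedBall_zero_iff] at hv
      have h2 := hmem (r ^ 2) v (by nlinarith [norm_nonneg v])
      have h3 : Differentiable ℂ fun v : ℂ => (-((r ^ 2 : ℝ) : ℂ) - conj η * v, η + v) := by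
        fun_prop
      exact ((hH.differentiableAt (hU.mem_nhds h2)).comp v (h3 v)).differentiableWithinAt
  -- `-F(-r²) / 2` is an antiderivative of `r` times the circular mean
  let F : ℂ → ℂ := orbit γ (fun p => f (p, η)) q
  have hfη : DifferentiableOn ℂ (fun p => f (p, η)) G :=
    hf.comp (f := fun p => (p, η)) (Differentiable.differentiableOn (by fun_prop)) fun p hp => by
      change scale γ _ p ∈ G
      simpa [scale_zero] using hp
  have hF : ∀ r : ℝ, DifferentiableAt ℂ F (-((r ^ 2 : ℝ) : ℂ)) := fun r =>
    differentiableAt_orbit hGo hfη (hG.scale_mem hγ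
      (by rw [Complex.neg_re, Complex.ofReal_re]; nlinarith [sq_nonneg r]) hq)
  have hA : ∀ r : ℝ, HasDerivAt (fun r : ℝ => -(1 / 2 : ℂ) * F (-((r ^ 2 : ℝ) : ℂ)))
      (r • H (-((r ^ 2 : ℝ) : ℂ), η)) r := by
    intro r
    have h1 : HasDerivAt (fun r : ℝ => -((r ^ 2 : ℝ) : ℂ)) (-((2 * r : ℝ) : ℂ)) r := by
      have := ((hasDerivAt_pow 2 r).ofReal_comp).fun_neg
      simpa using this
    have h2 := ((hF r).hasDerivAt.comp r h1).const_mul (-(1 / 2 : ℂ))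
    refine h2.congr_deriv ?_
    change _ = r • deriv F (-((r ^ 2 : ℝ) : ℂ))
    rw [Complex.real_smul]
    push_cast
    ring
  have key := integral_eq_of_hasDerivAt_circleAverage hJc hJint
    (A := fun r : ℝ => -(1 / 2 : ℂ) * F (-((r ^ 2 : ℝ) : ℂ)))
    (hA 0).continuousAt.continuousWithinAt
    (fun r hr => by rw [havg r hr]; exact hA r) ?_
  · rw [← integral_add_right_eq_self _ η]
    simp only [hJeq]
    rw [key]
    simp only [F, orbit, ne_eq, OfNat.ofNat_ne_zero, not_false_eq_true, zero_pow,
      Complex.ofReal_zero, neg_zero, mul_zero, Complex.exp_zero, scale_zero, one_mul,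
      Complex.real_smul]
    push_cast
    ring
  · have h1 : Tendsto (fun r : ℝ => -(r ^ 2)) atTop atBot :=
      tendsto_neg_atTop_atBot.comp (tendsto_pow_atTop two_ne_zero)
    have h2 := (tendsto_orbit_atBot hGo hG hγ hΓ hq hfη.continuousOn).comp h1
    have h3 := h2.const_mul (-(1 / 2 : ℂ))
    rw [mul_zero] at h3
    refine h3.congr fun r => ?_
    simp [F]

theorem isRepresenter_totalKernel (hGo : IsOpen G) (hG : IsPolydiscStable G)
    (hγ : ∀ j, 0 < γ j) (hΓ : 0 < ∑ j, γ j) {q : (Fin n → ℂ) × (Fin m → ℂ)} (hq : q ∈ G)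
    {k : (Fin n → ℂ) × (Fin m → ℂ) → ℂ} (hk : IsRepresenter G q k) :
    IsRepresenter (fibredDomain γ η G) (q, η) (totalKernel γ η k) := by
  have hmem := totalKernel_mem_bergmanSpace (η := η) hGo hG hγ hΓ hq hk
  refine ⟨hmem, fun f hf => ?_⟩
  obtain ⟨h1, h2⟩ := setIntegral_fibredDomain hGo (integrable_conj_mul_of_mem_bergmanSpace hmem hf)
  have hne : ∀ᵐ w : ℂ, w ≠ η := by simp [ae_iff]
  have h3 : ∀ᵐ w : ℂ, ∫ p in scale γ ((‖w‖ ^ 2 - ‖η‖ ^ 2) / 2 : ℝ) ⁻¹' G,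
      conj (totalKernel γ η k (p, w)) * f (p, w) = 1 / (Real.pi : ℂ) *
        deriv (orbit γ (fun p => f (p, w)) q) (conj w * η - (‖w‖ : ℂ) ^ 2) := by
    filter_upwards [hne, ae_fibre_mem_bergmanSpace hGo hf] with w hw hfw
    exact setIntegral_fibre_totalKernel hGo hG hγ hq hk hw hfw
  have hpi : (Real.pi : ℂ) ≠ 0 := by exact_mod_cast Real.pi_ne_zero
  have h4 := (h1.congr h3).const_mul (Real.pi : ℂ)
  rw [h2, integral_congr_ae h3, integral_const_mul,
    integral_deriv_orbit hGo hG hγ hΓ hq hf.1 (h4.congr (ae_of_all _ fun w => ?_))]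
  · field_simp
  · simp only
    field_simp

end Reproducing

/-! ### The Bergman space of a product with the plane -/

section ZeroDimensional

/-- Without coordinates to be contracted the target domain is `Ω × ℂ`, and its Bergman space is
trivial: the sub-mean value inequality holds over products with discs of arbitrary radius. -/
theorem apply_eq_zero_of_mem_bergmanSpace_prod {E : Type*} [NormedAddCommGroup E]
    [NormedSpace ℂ E] [FiniteDimensional ℂ E] [MeasureSpace E] [BorelSpace E]
    [(volume : Measure E).IsAddHaarMeasure] [SigmaFinite (volume : Measure E)]
    [BorelSpace (E × ℂ)] [(volume : Measure (E × ℂ)).IsAddHaarMeasure]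
    {Ω : Set E} (hΩ : IsOpen Ω) {f : E × ℂ → ℂ}
    (hf : f ∈ bergmanSpace {x : E × ℂ | x.1 ∈ Ω}) {x : E × ℂ} (hx : x.1 ∈ Ω) : f x = 0 := by
  have : ProperSpace E := FiniteDimensional.proper ℂ E
  obtain ⟨r, hr, hball⟩ := nhds_basis_closedBall.mem_iff.1 (hΩ.mem_nhds hx)
  have hopen : IsOpen {x : E × ℂ | x.1 ∈ Ω} := hΩ.preimage continuous_fst
  have hpos : 0 < volume.real (closedBall (0 : E) r) :=
    ENNReal.toReal_pos (measure_closedBall_pos _ _ hr).ne' measure_closedBall_lt_top.ne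
  have hbound : ∀ R : ℝ, 0 < R →
      ‖f x‖ * √(volume.real (closedBall (0 : E) r) * Real.pi) * R ≤
        bergmanNorm {x : E × ℂ | x.1 ∈ Ω} f := by
    intro R hR
    have hbal : Balanced ℂ (closedBall (0 : E) r ×ˢ closedBall (0 : ℂ) R) := by
      rintro a ha _ ⟨y, hy, rfl⟩
      exact ⟨(balanced_closedBall_zero (𝕜 := ℂ)).smul_mem ha hy.1,
        (balanced_closedBall_zero (𝕜 := ℂ)).smul_mem ha hy.2⟩
    have h := norm_mul_sqrt_le_bergmanNorm hopen hbal
      ((isCompact_closedBall _ _).prod (isCompact_closedBall _ _)) (p := x) (fun v hv => hball ?_) hf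
    · have hvol : volume.real (closedBall (0 : E) r ×ˢ closedBall (0 : ℂ) R) =
          volume.real (closedBall (0 : E) r) * Real.pi * R ^ 2 := by
        rw [Measure.volume_eq_prod, measureReal_prod_prod]
        have : volume.real (closedBall (0 : ℂ) R) = Real.pi * R ^ 2 := by
          rw [measureReal_def, Complex.volume_closedBall]
          simp [hR.le]
          ring
        rw [this, mul_assoc]
      rwa [hvol, Real.sqrt_mul (by positivity), Real.sqrt_sq hR.le, ← mul_assoc] at h
    · have := hv.1
      simpa [dist_eq_norm] using this
  by_contra hne
  have hc : 0 < ‖f x‖ * √(volume.real (closedBall (0 : E) r) * Real.pi) := by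
    have := norm_pos_iff.2 hne
    have := Real.pi_pos
    positivity
  set c := ‖f x‖ * √(volume.real (closedBall (0 : E) r) * Real.pi) with hcdef
  set N := bergmanNorm {x : E × ℂ | x.1 ∈ Ω} f with hN
  have h := hbound ((N + 1) / c) (by have := bergmanNorm_nonneg {x : E × ℂ | x.1 ∈ Ω} f; positivity)
  rw [mul_div_cancel₀ _ hc.ne'] at h
  linarith

end ZeroDimensional

/-! ### The target domain and the differential operator -/

section Target

variable {n m : ℕ} {γ : Fin n → ℝ} {Ω : Set ((Fin n → ℂ) × (Fin m → ℂ))}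

theorem gMap_eq_scale (γ : Fin n → ℝ) (q : (Fin n → ℂ) × (Fin m → ℂ)) (w : ℂ) :
    (gMap γ q.1 w, q.2) = scale γ ((‖w‖ ^ 2 / 2 : ℝ) : ℂ) q := by
  unfold gMap scale
  congr 1
  funext j
  push_cast
  congr 2
  ring

theorem lMap_eq_scale (γ : Fin n → ℝ) (z : Fin n → ℂ) (z' : Fin m → ℂ) (w η : ℂ) :
    (lMap γ z w η, z') = scale γ (w * conj η - (‖η‖ : ℂ) ^ 2) (z, z') := by
  unfold lMap scale
  congr 1
  funext j
  exact mul_comm _ _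

theorem sliceV_eq_preimage (γ : Fin n → ℝ) (Ω : Set ((Fin n → ℂ) × (Fin m → ℂ))) (η : ℂ) :
    sliceV γ Ω η = scale γ ((‖η‖ ^ 2 / 2 : ℝ) : ℂ) ⁻¹' Ω := by
  ext q
  change (gMap γ q.1 η, q.2) ∈ Ω ↔ _
  rw [gMap_eq_scale]
  rfl

theorem targetV_eq_fibredDomain (γ : Fin n → ℝ) (Ω : Set ((Fin n → ℂ) × (Fin m → ℂ))) (η : ℂ) :
    targetV γ Ω = fibredDomain γ η (sliceV γ Ω η) := by
  ext x
  rw [sliceV_eq_preimage]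
  change (gMap γ x.1.1 x.2, x.1.2) ∈ Ω ↔ scale γ _ (scale γ _ x.1) ∈ Ω
  rw [gMap_eq_scale, scale_scale]
  have : (((‖η‖ ^ 2 / 2 : ℝ) : ℂ) + ((‖x.2‖ ^ 2 - ‖η‖ ^ 2) / 2 : ℝ)) =
      ((‖x.2‖ ^ 2 / 2 : ℝ) : ℂ) := by push_cast; ring
  rw [this]

theorem operatorD_congr {F F' : (Fin n → ℂ) → ℂ} {z : Fin n → ℂ} (h : F =ᶠ[𝓝 z] F') (w η : ℂ) :
    operatorD γ w η F z = operatorD γ w η F' z := by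
  have hpartial : ∀ j, partialDeriv j F z = partialDeriv j F' z := fun j => by
    have hc : Tendsto (fun t : ℂ => Function.update z j t) (𝓝 (z j)) (𝓝 z) := by
      simpa using (hasDerivAt_update z j (z j)).continuousAt.tendsto
    exact Filter.EventuallyEq.deriv_eq (hc.eventually h)
  simp only [operatorD, hpartial, h.eq_of_nhds]

theorem differentiable_lMap (γ : Fin n → ℝ) (z' : Fin m → ℂ) (w η : ℂ) :
    Differentiable ℂ (fun u : Fin n → ℂ => (lMap γ u w η, z')) := by
  refine Differentiable.prodMk (differentiable_pi.2 fun j => ?_) (by fun_prop)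
  unfold lMap
  fun_prop

/-- The differential operator `D` is the derivative of the weighted orbit. -/
theorem operatorD_eq_deriv_orbit {G : Set ((Fin n → ℂ) × (Fin m → ℂ))} (hGo : IsOpen G)
    {k : (Fin n → ℂ) × (Fin m → ℂ) → ℂ} (hk : DifferentiableOn ℂ k G) {w η : ℂ}
    {z : Fin n → ℂ} {z' : Fin m → ℂ} (hz : (lMap γ z w η, z') ∈ G) :
    operatorD γ w η (fun u => k (lMap γ u w η, z')) z =
      1 / (Real.pi : ℂ) * deriv (orbit γ k (z, z')) (w * conj η - (‖η‖ : ℂ) ^ 2) := by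
  have hF : DifferentiableAt ℂ (fun u => k (lMap γ u w η, z')) z :=
    (hk.differentiableAt (hGo.mem_nhds hz)).comp z (differentiable_lMap γ z' w η z)
  set F : (Fin n → ℂ) → ℂ := fun u => k (lMap γ u w η, z') with hFdef
  set s : ℂ := w * conj η - (‖η‖ : ℂ) ^ 2 with hs
  have hpartial : ∀ j, partialDeriv j F z = fderiv ℂ F z (Pi.single j 1) := fun j => by
    have h := hasDerivAt_update z j (z j)
    have hF' : HasFDerivAt F (fderiv ℂ F z) (Function.update z j (z j)) := by
      rw [Function.update_eq_self]; exact hF.hasFDerivAt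
    exact (hF'.comp_hasDerivAt (z j) h).deriv
  have hsum : ∑ j, (γ j : ℂ) * (z j * partialDeriv j F z) =
      fderiv ℂ F z (fun j => (γ j : ℂ) * z j) := by
    conv_rhs => rw [pi_eq_sum_univ' (fun j => (γ j : ℂ) * z j)]
    rw [map_sum]
    refine Finset.sum_congr rfl fun j _ => ?_
    rw [hpartial, map_smul, smul_eq_mul, mul_assoc]
  have horbit : orbit γ k (z, z') = fun t => Complex.exp ((∑ j, γ j : ℝ) * t) *
      F (fun j => z j * Complex.exp ((γ j : ℂ) * (t - s))) := by
    funext t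
    rw [orbit, hFdef]
    simp only
    congr 2
    unfold scale lMap
    congr 1
    funext j
    simp only
    rw [mul_assoc, ← Complex.exp_add, ← hs, ← mul_add, sub_add_cancel, mul_comm]
  have hcurve : HasDerivAt (fun t : ℂ => fun j => z j * Complex.exp ((γ j : ℂ) * (t - s)))
      (fun j => (γ j : ℂ) * z j) s := by
    refine hasDerivAt_pi.2 fun j => ?_
    have h1 : HasDerivAt (fun t : ℂ => (γ j : ℂ) * (t - s)) (γ j : ℂ) s := by
      simpa using ((hasDerivAt_id s).sub_const s).const_mul (γ j : ℂ)
    have h2 := h1.cexp.const_mul (z j)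
    simp only [sub_self, mul_zero, Complex.exp_zero, one_mul] at h2
    rwa [mul_comm] at h2
  have hz0 : (fun j => z j * Complex.exp ((γ j : ℂ) * (s - s))) = z := by
    funext j; simp
  have hFs : HasFDerivAt F (fderiv ℂ F z)
      (fun j => z j * Complex.exp ((γ j : ℂ) * (s - s))) := by
    rw [hz0]; exact hF.hasFDerivAt
  have hFc : HasDerivAt (fun t : ℂ => F (fun j => z j * Complex.exp ((γ j : ℂ) * (t - s))))
      (fderiv ℂ F z (fun j => (γ j : ℂ) * z j)) s :=
    HasFDerivAt.comp_hasDerivAt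
      (f := fun t : ℂ => fun j => z j * Complex.exp ((γ j : ℂ) * (t - s))) s hFs hcurve
  have he : HasDerivAt (fun t : ℂ => Complex.exp ((∑ j, γ j : ℝ) * t))
      (Complex.exp ((∑ j, γ j : ℝ) * s) * (∑ j, γ j : ℝ)) s := by
    have h1 : HasDerivAt (fun t : ℂ => ((∑ j, γ j : ℝ) : ℂ) * t) ((∑ j, γ j : ℝ) : ℂ) s := by
      simpa using (hasDerivAt_id s).const_mul ((∑ j, γ j : ℝ) : ℂ)
    exact h1.cexp
  have hder := (he.mul hFc).deriv
  rw [hz0] at hder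
  change deriv (fun t => Complex.exp ((∑ j, γ j : ℝ) * t) *
      F (fun j => z j * Complex.exp ((γ j : ℂ) * (t - s)))) s = _ at hder
  rw [horbit, hder, operatorD, ← hs]
  simp only [mul_add, Finset.sum_add_distrib]
  rw [hsum, ← Finset.sum_mul]
  push_cast
  ring

end Target

end BergmanTarget

theorem theorem2 (n m : ℕ) (Ω : Set ((Fin n → ℂ) × (Fin m → ℂ)))
    (hΩ : BergmanTarget.IsStarShapedHartogs Ω)
    (γ : Fin n → ℝ) (hγ : ∀ j, 0 < γ j)
    (z : Fin n → ℂ) (z' : Fin m → ℂ) (w : ℂ) (ζ : Fin n → ℂ) (ζ' : Fin m → ℂ) (η : ℂ)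
    (hz : ((z, z'), w) ∈ BergmanTarget.targetV γ Ω)
    (hζ : ((ζ, ζ'), η) ∈ BergmanTarget.targetV γ Ω) :
    (BergmanTarget.lMap γ z w η, z') ∈ BergmanTarget.sliceV γ Ω η ∧
    DifferentiableAt ℂ (fun u : Fin n → ℂ =>
      BergmanTarget.bergmanKernel (BergmanTarget.sliceV γ Ω η)
        (BergmanTarget.lMap γ u w η, z') (ζ, ζ')) z ∧
    BergmanTarget.bergmanKernel (BergmanTarget.targetV γ Ω) ((z, z'), w) ((ζ, ζ'), η) =
      BergmanTarget.operatorD γ w η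
        (fun u : Fin n → ℂ =>
          BergmanTarget.bergmanKernel (BergmanTarget.sliceV γ Ω η)
            (BergmanTarget.lMap γ u w η, z') (ζ, ζ')) z := by
  have hGo : IsOpen (BergmanTarget.sliceV γ Ω η) := by
    rw [BergmanTarget.sliceV_eq_preimage]
    exact BergmanTarget.isOpen_preimage_scale hΩ.isOpen _
  have hG : BergmanTarget.IsPolydiscStable (BergmanTarget.sliceV γ Ω η) := by
    rw [BergmanTarget.sliceV_eq_preimage]
    exact BergmanTarget.isPolydiscStable_preimage_scale hΩ.smul_mem _
  have hV := BergmanTarget.targetV_eq_fibredDomain γ Ω η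
  have hVo : IsOpen (BergmanTarget.targetV γ Ω) := by
    rw [hV]
    exact BergmanTarget.isOpen_fibredDomain hGo
  have hl : (BergmanTarget.lMap γ z w η, z') ∈ BergmanTarget.sliceV γ Ω η := by
    rw [BergmanTarget.lMap_eq_scale]
    exact hG.scale_mem_of_mem_fibredDomain hγ (x := ((z, z'), w)) (hV ▸ hz)
  obtain ⟨k, hk⟩ := BergmanTarget.exists_isRepresenter hGo (p := (ζ, ζ')) hζ
  have hlc := BergmanTarget.differentiable_lMap γ z' w η z
  have hev : (fun u : Fin n → ℂ => BergmanTarget.bergmanKernel (BergmanTarget.sliceV γ Ω η)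
      (BergmanTarget.lMap γ u w η, z') (ζ, ζ')) =ᶠ[nhds z]
      fun u => k (BergmanTarget.lMap γ u w η, z') := by
    filter_upwards [hlc.continuousAt.preimage_mem_nhds (hGo.mem_nhds hl)] with u hu
    exact BergmanTarget.bergmanKernel_eq hGo hu hk
  refine ⟨hl, ?_, ?_⟩
  · refine DifferentiableAt.congr_of_eventuallyEq ?_ hev
    exact (hk.1.1.differentiableAt (hGo.mem_nhds hl)).comp z hlc
  · obtain rfl | hn := Nat.eq_zero_or_pos n
    · -- both sides vanish: the operator is an empty sum
      obtain ⟨K, hK⟩ := BergmanTarget.exists_isRepresenter hVo hζ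
      have hprod : BergmanTarget.targetV γ Ω = {x | x.1 ∈ Ω} := by
        ext x
        change (BergmanTarget.gMap γ x.1.1 x.2, x.1.2) ∈ Ω ↔ x.1 ∈ Ω
        rw [Subsingleton.elim (BergmanTarget.gMap γ x.1.1 x.2) x.1.1]
      have hK0 : K ((z, z'), w) = 0 :=
        BergmanTarget.apply_eq_zero_of_mem_bergmanSpace_prod hΩ.isOpen (hprod ▸ hK.1)
          (x := ((z, z'), w)) (by have := hz; rw [hprod] at this; exact this)
      rw [BergmanTarget.bergmanKernel_eq hVo hz hK, hK0]
      simp [BergmanTarget.operatorD]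
    · have hΓ : 0 < ∑ j, γ j :=
        Finset.sum_pos (fun j _ => hγ j) ⟨⟨0, hn⟩, Finset.mem_univ _⟩
      have hrep := BergmanTarget.isRepresenter_totalKernel (η := η) hGo hG hγ hΓ
        (q := (ζ, ζ')) hζ hk
      rw [← hV] at hrep
      rw [BergmanTarget.operatorD_congr hev, BergmanTarget.operatorD_eq_deriv_orbit hGo hk.1.1 hl,
        BergmanTarget.bergmanKernel_eq hVo hz hrep]
      rfl
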